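/- Let $N_t\ge 1$, let $\Omega_t=[0,1]^{N_t}$ be the parameter domain, and let $l$ be an integer with $l>\frac{N_t}{2}+2$. There is a constant $C=C(N_t,l)$, depending only on $N_t$ and $l$, such that the following holds. Let $\Omega_x\subset\mathbb{R}^d$ be a bounded open set, let $\mu_0,\dots,\mu_{N_t}\in L^\infty(\Omega_x)$, and suppose that $\mu(x,t)=\mu_0(x)+\sum_{i=1}^{N_t}t_i\mu_i(x)$ satisfies $0<\mu_{\min}\le\mu(x,t)\le\mu_{\max}<\infty$ for a.e. $(x,t)\in\Omega_x\times\Omega_t$. Let $f(t)=f_0+\sum_{i=1}^{N_t}t_if_i$ with $f_0,\dots,f_{N_t}\in H^{-1}(\Omega_x)=H^1_0(\Omega_x)'$. Let $V_h\subset H^1_0(\Omega_x)$ be a finite-dimensional subspace (for example a finite element space) with basis $\varphi_1,\dots,\varphi_K$. Then for every $t\in\Omega_t$ there is a unique Galerkin solution $u_h(\cdot,t)=\sum_{k=1}^K u_k(t)\varphi_k\in V_h$, i.e. $$\int_{\Omega_x}\nabla u_h(\cdot,t)\cdot\nabla v\,dx+\int_{\Omega_x}\mu(\cdot,t)\,u_h(\cdot,t)\,v\,dx=\langle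 f(t),v\rangle\qquad\forall v\in V_h,$$ and each coefficient function $u_k:\Omega_t\to\mathbb{R}$ belongs to $H^l(\Omega_t)$ and to the Barron space $\mathcal{B}(\Omega_t)$, with $$\|u_k\|_{\mathcal{B}(\Omega_t)}\le C\,\|u_k\|_{H^l(\Omega_t)} .$$ Here $H^l(\Omega_t)$ denotes the Sobolev space on the interior of $\Omega_t$, with norm $\|g\|_{H^l(\Omega_t)}=\bigl(\sum_{|\alpha|\le l}\|\partial^\alpha g\|_{L^2(\Omega_t)}^2\bigr)^{1/2}$. With $\sigma(z)=\max(0,z)$, $\mathcal{B}(\Omega_t)$ is the set of $g:\Omega_t\to\mathbb{R}$ that have a representation $g(t)=\int w\,\sigma(b\cdot t+c)\,\rho(db,dc,dw)$ for all $t\in\Omega_t$, with $\rho$ a Borel probability measure on $\mathbb{R}^{N_t}\times\mathbb{R}\times\mathbb{R}$ and the integrand $\rho$-integrable for every $t\in\Omega_t$, for which $\|g\|_{\mathcal{B}(\Omega_t)}=\inf_\rho\int|w|(\|b\|+|c|)\,\rho(db,dc,dw)$ is finite, the infimum being over all such representations of $g$; $\|b\|$ is the Euclidean norm. -/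

import Mathlib

open MeasureTheory
open scoped ENNReal NNReal ContDiff

noncomputable section

/-! ### The parameter domain and Sobolev spaces of integer order -/

/-- The parameter domain `[0,1]^N` in Euclidean space. -/
def paramDomain (N : ℕ) : Set (EuclideanSpace ℝ (Fin N)) :=
  {t | ∀ i, t i ∈ Set.Icc (0 : ℝ) 1}

/-- Smooth functions with compact support in `U`. -/
def IsTestFunction {n : ℕ} (U : Set (EuclideanSpace ℝ (Fin n)))
    (ψ : EuclideanSpace ℝ (Fin n) → ℝ) : Prop :=
  ContDiff ℝ ∞ ψ ∧ HasCompactSupport ψ ∧ tsupport ψ ⊆ U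

/-- The classical partial derivative `∂ψ/∂t_i`. -/
def partialDeriv {n : ℕ} (i : Fin n) (ψ : EuclideanSpace ℝ (Fin n) → ℝ) :
    EuclideanSpace ℝ (Fin n) → ℝ :=
  fun t => fderiv ℝ ψ t (EuclideanSpace.single i 1)

/-- The classical derivative `∂^α ψ = ∂_0^{α_0} ∂_1^{α_1} ⋯ ψ` for a multi-index `α`. -/
def multiDeriv {n : ℕ} (α : Fin n → ℕ) (ψ : EuclideanSpace ℝ (Fin n) → ℝ) :
    EuclideanSpace ℝ (Fin n) → ℝ :=
  (List.finRange n).foldr (fun i h => (partialDeriv i)^[α i] h) ψ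

/-- `g` is a weak derivative `∂^α u` on the open set `U`. -/
def HasWeakDeriv {n : ℕ} (U : Set (EuclideanSpace ℝ (Fin n))) (α : Fin n → ℕ)
    (u g : EuclideanSpace ℝ (Fin n) → ℝ) : Prop :=
  LocallyIntegrableOn u U ∧ LocallyIntegrableOn g U ∧
    ∀ ψ, IsTestFunction U ψ →
      ∫ t in U, u t * multiDeriv α ψ t = (-1) ^ (∑ i, α i) * ∫ t in U, g t * ψ t

/-- The multi-indices `α` with `|α| ≤ l`. -/
def multiIndices (n l : ℕ) : Finset (Fin n → ℕ) :=
  (Fintype.piFinset fun _ : Fin n => Finset.range (l + 1)).filter fun α => ∑ i, α i ≤ l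

/-- `u ∈ H^l(U)`: all weak derivatives of order at most `l` exist and are in `L²(U)`. -/
def MemSobolev {n : ℕ} (U : Set (EuclideanSpace ℝ (Fin n))) (l : ℕ)
    (u : EuclideanSpace ℝ (Fin n) → ℝ) : Prop :=
  ∀ α ∈ multiIndices n l, ∃ g, HasWeakDeriv U α u g ∧ MemLp g 2 (volume.restrict U)

/-- The norm `‖u‖_{H^l(U)} = (∑_{|α| ≤ l} ‖∂^α u‖²_{L²(U)})^{1/2}`. Weak derivatives are unique
almost everywhere, so all families `g` give the same value; the infimum selects that value, and
it is `∞` when some weak derivative does not exist. -/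
def sobolevNorm {n : ℕ} (U : Set (EuclideanSpace ℝ (Fin n))) (l : ℕ)
    (u : EuclideanSpace ℝ (Fin n) → ℝ) : ℝ≥0∞ :=
  ⨅ (g : (Fin n → ℕ) → EuclideanSpace ℝ (Fin n) → ℝ)
    (_ : ∀ α ∈ multiIndices n l, HasWeakDeriv U α u (g α)),
    (∑ α ∈ multiIndices n l, eLpNorm (g α) 2 (volume.restrict U) ^ 2) ^ (1 / 2 : ℝ)

/-! ### The Barron space of two-layer ReLU networks -/

/-- `f(t) = ∫ w σ(b · t + c) ρ(db, dc, dw)` for all `t ∈ S`, with `σ` the ReLU activation and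
`ρ` a probability measure. -/
def IsBarronRepresentation {n : ℕ} (S : Set (EuclideanSpace ℝ (Fin n)))
    (f : EuclideanSpace ℝ (Fin n) → ℝ)
    (ρ : Measure (EuclideanSpace ℝ (Fin n) × ℝ × ℝ)) : Prop :=
  IsProbabilityMeasure ρ ∧
    ∀ t ∈ S, Integrable (fun p => p.2.2 * max 0 (inner ℝ p.1 t + p.2.1)) ρ ∧
      f t = ∫ p, p.2.2 * max 0 (inner ℝ p.1 t + p.2.1) ∂ρ

/-- The Barron norm: the infimum of `∫ |w| (‖b‖ + |c|) dρ` over all representations `ρ` of `f`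
on `S` (`∞` if there is none). -/
def barronNorm {n : ℕ} (S : Set (EuclideanSpace ℝ (Fin n)))
    (f : EuclideanSpace ℝ (Fin n) → ℝ) : ℝ≥0∞ :=
  ⨅ (ρ : Measure (EuclideanSpace ℝ (Fin n) × ℝ × ℝ)) (_ : IsBarronRepresentation S f ρ),
    ∫⁻ p, ENNReal.ofReal (|p.2.2| * (‖p.1‖ + |p.2.1|)) ∂ρ

/-- `f` belongs to the Barron space `𝓑(S)`. -/
def MemBarron {n : ℕ} (S : Set (EuclideanSpace ℝ (Fin n)))
    (f : EuclideanSpace ℝ (Fin n) → ℝ) : Prop :=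
  barronNorm S f < ⊤

/-! ### The space `H¹₀(Ω)`, its dual, and the Galerkin problem -/

/-- The Hilbert space `L²(Ω) × L²(Ω; ℝ^d)` in which `H¹₀(Ω)` sits by `v ↦ (v, ∇v)`, with the
norm `(‖v‖² + ‖∇v‖²)^{1/2}`. -/
abbrev SobolevAmbient {d : ℕ} (Ω : Set (EuclideanSpace ℝ (Fin d))) : Type :=
  WithLp 2 (Lp ℝ 2 (volume.restrict Ω) × Lp (EuclideanSpace ℝ (Fin d)) 2 (volume.restrict Ω))

/-- `H¹₀(Ω)`: the closure of the test functions on `Ω` in the `H¹` norm. An element is the pair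
of a function and its weak gradient. The spanning set is already a linear subspace. -/
def H10 {d : ℕ} (Ω : Set (EuclideanSpace ℝ (Fin d))) : Submodule ℝ (SobolevAmbient Ω) :=
  (Submodule.span ℝ {p : SobolevAmbient Ω | ∃ φ, IsTestFunction Ω φ ∧
    p.fst =ᵐ[volume.restrict Ω] φ ∧ p.snd =ᵐ[volume.restrict Ω] gradient φ}).topologicalClosure

/-- The affine potential `μ(x,t) = μ_0(x) + ∑ t_i μ_i(x)`. -/
def potential {d N : ℕ} (μ₀ : EuclideanSpace ℝ (Fin d) → ℝ)
    (μ : Fin N → EuclideanSpace ℝ (Fin d) → ℝ)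
    (x : EuclideanSpace ℝ (Fin d)) (t : EuclideanSpace ℝ (Fin N)) : ℝ :=
  μ₀ x + ∑ i, t i * μ i x

/-- The bilinear form `(∇v, ∇w)_Ω + (m v, w)_Ω` on `H¹₀(Ω)`. -/
def energyForm {d : ℕ} (Ω : Set (EuclideanSpace ℝ (Fin d)))
    (m : EuclideanSpace ℝ (Fin d) → ℝ) (v w : H10 Ω) : ℝ :=
  (∫ x in Ω, inner ℝ (v.1.snd x) (w.1.snd x)) + ∫ x in Ω, m x * v.1.fst x * w.1.fst x

/-- The coefficient vector `c` describes the Galerkin solution `∑ c_k φ_k` in the space `V` with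
basis `φ`, for the parameter value `t` and the right-hand side `f_0 + ∑ t_i f_i` in
`H⁻¹(Ω) = H¹₀(Ω)'`. -/
def IsGalerkinCoeff {d N K : ℕ} (Ω : Set (EuclideanSpace ℝ (Fin d)))
    (μ₀ : EuclideanSpace ℝ (Fin d) → ℝ) (μ : Fin N → EuclideanSpace ℝ (Fin d) → ℝ)
    (f₀ : StrongDual ℝ (H10 Ω)) (f : Fin N → StrongDual ℝ (H10 Ω))
    (V : Submodule ℝ (H10 Ω)) (φ : Module.Basis (Fin K) ℝ V)
    (t : EuclideanSpace ℝ (Fin N)) (c : Fin K → ℝ) : Prop :=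
  ∀ v ∈ V, energyForm Ω (fun x => potential μ₀ μ x t) (∑ k, c k • (φ k : H10 Ω)) v
    = f₀ v + ∑ i, t i * f i v

end

/-! Since the constant may not depend on the Galerkin data, the equation contributes only one
qualitative fact: on the cube each coefficient u_k coincides with a function G that is smooth on all
of ℝ^N. The quantitative part is the bound of the Barron norm by the H^l norm for restrictions of
such G.

The qualitative part. In the basis φ the Galerkin problem is a linear system A(t)c = b(t) with A and
b affine in t. Continuity in t turns the almost-everywhere lower bound on μ into one valid, for a.e.
x, at every t of the closed cube. The energy form is therefore definite there and det A(t) ≠ 0.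
Cramer's rule, with the determinant in the denominator regularised away from the cube, gives G
(`exists_contDiff_eq_of_mulVec_eq`).

The quantitative part is Barron's argument. Fourier inversion writes a function F on ℝ^N as a
superposition of exp(iz) with z = 2πξ·t. Taylor's formula of second order has the remainder kernel
max(0, z - s), so each exponential is a superposition of ReLU ridge functions, of total cost at most
a constant times (1+‖ξ‖)² (`barronNorm_le_lintegral_fourier`). Cauchy–Schwarz against (1+‖ξ‖)^(2-l),
which is square integrable because l > N/2 + 2, and Plancherel bound the integral of (1+‖ξ‖)²|F̂| by
the L² norms of F and of the ∂_i^l F (`lintegral_sq_mul_fourier_le`).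

This needs a compactly supported F on the whole space. It is obtained from G by higher-order
reflections across the faces of the cube, followed by a cutoff (`exists_extension_compactSupport`).
Only pure derivatives ∂_i^m occur in the estimates: a coordinate derivative of a reflection
extension is again one, with other coefficients. Finally the weak derivatives in the Sobolev norm
agree a.e. with the classical derivatives of G (`eLpNorm_iterate_partialDeriv_le_sobolevNorm`). -/

/-! ### Plancherel and weighted L¹ bounds for the Fourier transform. -/

open FourierTransform SchwartzMap in
-- Both transforms define the same distribution: paired with a test function g, each gives ∫ ĝ h,
-- the first by compatibility with tempered distributions, the second by Fubini. Test functions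
-- separate locally integrable functions.
theorem fourier_toLp_ae_eq {E : Type*} [NormedAddCommGroup E] [InnerProductSpace ℝ E]
    [FiniteDimensional ℝ E] [MeasurableSpace E] [BorelSpace E] {h : E → ℂ}
    (h1 : Integrable h) (h2 : MemLp h 2) :
    (𝓕 (h2.toLp h) : Lp ℂ 2 (volume : Measure E)) =ᵐ[volume] 𝓕 h := by
  have hc : Continuous (𝓕 h) := by
    exact VectorFourier.fourierIntegral_continuous Real.continuous_fourierChar
      (by exact continuous_inner) h1
  have hloc : LocallyIntegrable (fun x => (𝓕 (h2.toLp h) : Lp ℂ 2 (volume : Measure E)) x - 𝓕 h x) :=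
    ((Lp.memLp _).locallyIntegrable (by norm_num)).sub hc.locallyIntegrable
  have key : ∀ g : E → ℝ, ContDiff ℝ ∞ g → HasCompactSupport g →
      ∫ x, g x • ((𝓕 (h2.toLp h) : Lp ℂ 2 (volume : Measure E)) x - 𝓕 h x) = 0 := by
    intro g hg hgc
    let gs : 𝓢(E, ℂ) := HasCompactSupport.toSchwartzMap (f := fun x => (g x : ℂ))
      (hgc.comp_left (g := fun r : ℝ => (r : ℂ)) (by simp)) (Complex.ofRealCLM.contDiff.comp hg)
    have hgs : ∀ x, gs x = (g x : ℂ) := fun x => rfl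
    have e1 := congrArg (fun T => T gs) (Lp.fourier_toTemperedDistribution_eq (h2.toLp h))
    simp only [TemperedDistribution.fourier_apply, Lp.toTemperedDistribution_apply] at e1
    have e2 : ∫ x, (𝓕 gs) x • (h2.toLp h) x = ∫ x, (𝓕 gs) x • h x := by
      refine integral_congr_ae ?_
      filter_upwards [h2.coeFn_toLp] with x hx
      rw [hx]
    have e3 : ∫ x, (𝓕 gs) x • h x = ∫ x, gs x • 𝓕 h x := by
      have := VectorFourier.integral_fourierIntegral_smul_eq_flip (μ := volume) (ν := volume)
        (L := innerₗ E) Real.continuous_fourierChar (by exact continuous_inner)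
        gs.integrable h1
      rw [flip_innerₗ] at this
      exact this
    simp only [hgs] at e1 e3
    have i1 : Integrable fun x => g x • (𝓕 (h2.toLp h) : Lp ℂ 2 (volume : Measure E)) x :=
      ((Lp.memLp _).locallyIntegrable (by norm_num)).integrable_smul_left_of_hasCompactSupport
        hg.continuous hgc
    have i2 : Integrable fun x => g x • 𝓕 h x :=
      hc.locallyIntegrable.integrable_smul_left_of_hasCompactSupport hg.continuous hgc
    simp only [smul_sub]
    rw [integral_sub i1 i2, sub_eq_zero]
    simp only [← Complex.coe_smul] at *
    rw [← e1, e2, e3]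
  have := ae_eq_zero_of_integral_contDiff_smul_eq_zero hloc key
  filter_upwards [this] with x hx
  exact sub_eq_zero.mp hx

open FourierTransform in
/-- Plancherel's identity for functions in `L¹ ∩ L²`. -/
theorem eLpNorm_fourier_eq {E : Type*} [NormedAddCommGroup E] [InnerProductSpace ℝ E]
    [FiniteDimensional ℝ E] [MeasurableSpace E] [BorelSpace E] {h : E → ℂ}
    (h1 : Integrable h) (h2 : MemLp h 2) : eLpNorm (𝓕 h) 2 volume = eLpNorm h 2 volume := by
  rw [← eLpNorm_congr_ae (fourier_toLp_ae_eq h1 h2), ← Lp.enorm_def, ← eLpNorm_congr_ae h2.coeFn_toLp,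
    ← Lp.enorm_def, enorm_eq_iff_norm_eq, Lp.norm_fourier_eq]

open FourierTransform in
theorem fourier_fderiv_apply {E : Type*} [NormedAddCommGroup E] [InnerProductSpace ℝ E]
    [FiniteDimensional ℝ E] [MeasurableSpace E] [BorelSpace E] {F : E → ℂ}
    (hF : ContDiff ℝ 1 F) (hc : HasCompactSupport F) (v ξ : E) :
    𝓕 (fun x => fderiv ℝ F x v) ξ = (2 * Real.pi * Complex.I * (inner ℝ ξ v : ℝ)) * 𝓕 F ξ := by
  have hi : Integrable (fderiv ℝ F) :=
    (hF.continuous_fderiv (by norm_num)).integrable_of_hasCompactSupport (hc.fderiv ℝ)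
  have := congrArg (fun T => T ξ v) (Real.fourier_fderiv
    (hF.continuous.integrable_of_hasCompactSupport hc) (hF.differentiable (by norm_num)) hi)
  simp only [VectorFourier.fourierSMulRight_apply] at this
  rw [Real.fourier_continuousLinearMap_apply hi] at this
  rw [this]
  change -(2 * Real.pi * Complex.I) • (-(inner ℝ ξ v) : ℝ) • 𝓕 F ξ = _
  rw [Complex.real_smul, smul_eq_mul]
  push_cast
  ring

theorem ContDiff.partialDeriv {n : ℕ} {m : ℕ∞} {F : EuclideanSpace ℝ (Fin n) → ℝ}
    (hF : ContDiff ℝ (m + 1 : ℕ∞) F) (i : Fin n) : ContDiff ℝ m (partialDeriv i F) :=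
  (hF.fderiv_right (m := m) (by norm_cast)).clm_apply contDiff_const

theorem ContDiff.iterate_partialDeriv {n : ℕ} {F : EuclideanSpace ℝ (Fin n) → ℝ} (i : Fin n)
    (m k : ℕ) (hF : ContDiff ℝ (m + k : ℕ) F) : ContDiff ℝ m ((_root_.partialDeriv i)^[k] F) := by
  induction k generalizing F with
  | zero => simpa using hF
  | succ k ih =>
    rw [Function.iterate_succ_apply]
    exact ih (ContDiff.partialDeriv (m := ((m + k : ℕ) : ℕ∞)) (by exact_mod_cast hF) i)

theorem HasCompactSupport.partialDeriv {n : ℕ} {F : EuclideanSpace ℝ (Fin n) → ℝ}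
    (hF : HasCompactSupport F) (i : Fin n) : HasCompactSupport (partialDeriv i F) :=
  hF.fderiv_apply (𝕜 := ℝ) _

theorem HasCompactSupport.iterate_partialDeriv {n : ℕ} {F : EuclideanSpace ℝ (Fin n) → ℝ}
    (hF : HasCompactSupport F) (i : Fin n) (k : ℕ) :
    HasCompactSupport ((_root_.partialDeriv i)^[k] F) := by
  induction k with
  | zero => exact hF
  | succ k ih => rw [Function.iterate_succ_apply']; exact ih.partialDeriv i

open FourierTransform in
theorem fourier_partialDeriv {n : ℕ} {F : EuclideanSpace ℝ (Fin n) → ℝ}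
    (hF : ContDiff ℝ 1 F) (hc : HasCompactSupport F) (i : Fin n) (ξ : EuclideanSpace ℝ (Fin n)) :
    𝓕 (fun x => (partialDeriv i F x : ℂ)) ξ
      = (2 * Real.pi * Complex.I * (ξ i : ℝ)) * 𝓕 (fun x => (F x : ℂ)) ξ := by
  have h := fourier_fderiv_apply (F := fun x => (F x : ℂ)) (Complex.ofRealCLM.contDiff.comp hF)
    (hc.comp_left (g := fun r : ℝ => (r : ℂ)) (by simp)) (EuclideanSpace.single i 1) ξ
  rw [EuclideanSpace.inner_single_right] at h
  simp only [one_mul, conj_trivial] at h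
  rw [← h]
  refine congrFun (congrArg _ (funext fun x => ?_)) ξ
  have : HasFDerivAt (fun x => (F x : ℂ)) (Complex.ofRealCLM.comp (fderiv ℝ F x)) x :=
    Complex.ofRealCLM.hasFDerivAt.comp x (hF.differentiable (by norm_num) x).hasFDerivAt
  rw [this.fderiv]
  simp [partialDeriv]

open FourierTransform in
theorem fourier_iterate_partialDeriv {n : ℕ} {F : EuclideanSpace ℝ (Fin n) → ℝ} {k : ℕ}
    (hF : ContDiff ℝ k F) (hc : HasCompactSupport F) (i : Fin n) (ξ : EuclideanSpace ℝ (Fin n)) :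
    𝓕 (fun x => ((partialDeriv i)^[k] F x : ℂ)) ξ
      = (2 * Real.pi * Complex.I * (ξ i : ℝ)) ^ k * 𝓕 (fun x => (F x : ℂ)) ξ := by
  induction k with
  | zero => simp
  | succ k ih =>
    have h1 : ContDiff ℝ 1 ((partialDeriv i)^[k] F) := by
      have := ContDiff.iterate_partialDeriv i 1 k (F := F) (by rwa [add_comm])
      exact_mod_cast this
    simp only [Function.iterate_succ_apply']
    rw [fourier_partialDeriv h1 (hc.iterate_partialDeriv i k),
      ih (hF.of_le (by exact_mod_cast Nat.le_succ k))]
    ring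

/-- Pure powers suffice on the right because ‖ξ‖ is at most the ℓ¹ norm, to which the power mean
inequality applies. This is why mixed derivatives are never needed. -/
theorem one_add_norm_pow_le {n : ℕ} (l : ℕ) (ξ : EuclideanSpace ℝ (Fin n)) :
    (1 + ‖ξ‖) ^ (l + 1) ≤ (2 ^ l * (1 + n ^ l)) * (1 + ∑ i, |ξ i| ^ (l + 1)) := by
  have h1 : ‖ξ‖ ≤ ∑ i, |ξ i| := by
    have h0 : ‖ξ‖ ^ 2 ≤ (∑ i, |ξ i|) ^ 2 := by
      rw [EuclideanSpace.norm_sq_eq]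
      simpa using Finset.sum_sq_le_sq_sum_of_nonneg (s := Finset.univ) (f := fun i => |ξ i|)
        (fun i _ => abs_nonneg _)
    exact le_of_sq_le_sq h0 (by positivity)
  have h2 : (∑ i, |ξ i|) ^ (l + 1) ≤ n ^ l * ∑ i, |ξ i| ^ (l + 1) := by
    rcases Nat.eq_zero_or_pos n with rfl | hn
    · simp
    have := pow_sum_div_card_le_sum_pow (s := Finset.univ) (f := fun i => |ξ i|) (n := l)
      (fun i _ => abs_nonneg _)
    rw [div_le_iff₀ (by simp; positivity)] at this
    simp only [Finset.card_univ, Fintype.card_fin] at this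
    linarith
  have hS : 0 ≤ ∑ i, |ξ i| ^ (l + 1) := by positivity
  calc (1 + ‖ξ‖) ^ (l + 1) ≤ 2 ^ l * (1 ^ (l + 1) + ‖ξ‖ ^ (l + 1)) := by
        simpa using add_pow_le zero_le_one (norm_nonneg ξ) (l + 1)
    _ ≤ 2 ^ l * (1 + n ^ l * ∑ i, |ξ i| ^ (l + 1)) := by
        rw [one_pow]
        gcongr
        exact (pow_le_pow_left₀ (norm_nonneg ξ) h1 _).trans h2
    _ ≤ _ := by
        rw [mul_assoc]
        gcongr
        have : (0 : ℝ) ≤ (n : ℝ) ^ l := by positivity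
        nlinarith

open FourierTransform in
-- Cauchy–Schwarz applied to (1+‖ξ‖)^(2-l) · (1+‖ξ‖)^l |F̂|. Plancherel bounds the second factor,
-- since |ξ_i|^l |F̂| is at most the transform of ∂_i^l F in modulus.
theorem lintegral_sq_mul_fourier_le (n l : ℕ) (hl : (n : ℝ) / 2 + 2 < l) :
    ∃ C : ℝ≥0, ∀ F : EuclideanSpace ℝ (Fin n) → ℝ, ContDiff ℝ l F → HasCompactSupport F →
      ∫⁻ ξ, ENNReal.ofReal ((1 + ‖ξ‖) ^ 2 * ‖𝓕 (fun x => (F x : ℂ)) ξ‖)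
        ≤ C * (eLpNorm F 2 volume + ∑ i, eLpNorm ((partialDeriv i)^[l] F) 2 volume) := by
  obtain ⟨k, rfl⟩ : ∃ k, l = k + 1 := ⟨l - 1, by
    have : (0 : ℝ) < l := by linarith [show (0 : ℝ) ≤ n by positivity]
    have : 0 < l := by exact_mod_cast this
    omega⟩
  let w : EuclideanSpace ℝ (Fin n) → ℝ := fun ξ => (1 + ‖ξ‖) ^ (2 - ((k + 1 : ℕ) : ℝ))
  have hwc : Continuous w := by
    refine Continuous.rpow_const (by fun_prop) fun ξ => Or.inl (by positivity)
  have hw : MemLp w 2 volume := by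
    rw [memLp_two_iff_integrable_sq hwc.aestronglyMeasurable]
    -- The square of `w` has exponent -(2l - 4), and integrability needs 2l - 4 > n: this is the
    -- condition l > n/2 + 2.
    have := integrable_one_add_norm (E := EuclideanSpace ℝ (Fin n)) (μ := volume)
      (r := 2 * ((k + 1 : ℕ) : ℝ) - 4) (by simp at hl ⊢; linarith)
    refine this.congr (Filter.Eventually.of_forall fun ξ => ?_)
    simp only [w]
    rw [← Real.rpow_natCast, ← Real.rpow_mul (by positivity)]
    congr 1
    push_cast
    ring
  set A : ℝ≥0 := 2 ^ k * (1 + n ^ k) with hA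
  refine ⟨(eLpNorm w 2 volume).toNNReal * A, fun F hF hc => ?_⟩
  have hwn : ((eLpNorm w 2 volume).toNNReal : ℝ≥0∞) = eLpNorm w 2 volume :=
    ENNReal.coe_toNNReal hw.eLpNorm_ne_top
  have fc : ∀ G : EuclideanSpace ℝ (Fin n) → ℝ, Continuous G → HasCompactSupport G →
      Continuous (𝓕 (fun x => (G x : ℂ))) ∧
      eLpNorm (𝓕 (fun x => (G x : ℂ))) 2 volume = eLpNorm G 2 volume := by
    intro G hG hGc
    have c1 : Continuous fun x => (G x : ℂ) := by fun_prop
    have c2 : HasCompactSupport fun x => (G x : ℂ) :=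
      hGc.comp_left (g := fun r : ℝ => (r : ℂ)) (by simp)
    refine ⟨VectorFourier.fourierIntegral_continuous Real.continuous_fourierChar
      (by exact continuous_inner) (c1.integrable_of_hasCompactSupport c2), ?_⟩
    rw [eLpNorm_fourier_eq (c1.integrable_of_hasCompactSupport c2)
      (c1.memLp_of_hasCompactSupport c2)]
    exact eLpNorm_congr_norm_ae (Filter.Eventually.of_forall fun x => by simp)
  have f0 := fc F hF.continuous hc
  have fi := fun i => fc ((partialDeriv i)^[k + 1] F)
    (ContDiff.iterate_partialDeriv i 0 (k + 1) (by simpa using hF)).continuous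
    (hc.iterate_partialDeriv i _)
  set Fh := 𝓕 (fun x => (F x : ℂ)) with hFh
  let D : Fin n → EuclideanSpace ℝ (Fin n) → ℂ :=
    fun i => 𝓕 (fun x => ((partialDeriv i)^[k + 1] F x : ℂ))
  let g : EuclideanSpace ℝ (Fin n) → ℝ := fun ξ => (1 + ‖ξ‖) ^ (k + 1) * ‖Fh ξ‖
  have hgc : Continuous g := by
    have := f0.1
    fun_prop
  have hg : eLpNorm g 2 volume ≤
      A * (eLpNorm F 2 volume + ∑ i, eLpNorm ((partialDeriv i)^[k + 1] F) 2 volume) := by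
    have p1 : ∀ ξ, ‖g ξ‖ ≤ A * ‖(fun ξ => ‖Fh ξ‖ + ∑ i, ‖D i ξ‖) ξ‖ := by
      intro ξ
      have b := one_add_norm_pow_le k ξ
      have hD : ∀ i, |ξ i| ^ (k + 1) * ‖Fh ξ‖ ≤ ‖D i ξ‖ := by
        intro i
        simp only [D]
        rw [fourier_iterate_partialDeriv hF hc i ξ, norm_mul, norm_pow]
        refine mul_le_mul_of_nonneg_right (pow_le_pow_left₀ (abs_nonneg _) ?_ _) (norm_nonneg _)
        simp only [norm_mul, Complex.norm_I, Complex.norm_real, Real.norm_eq_abs,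
          Complex.norm_ofNat, mul_one, abs_of_pos Real.pi_pos]
        nlinarith [Real.pi_gt_three, abs_nonneg (ξ i)]
      have hpos : 0 ≤ ‖Fh ξ‖ + ∑ i, ‖D i ξ‖ := by positivity
      rw [Real.norm_of_nonneg (by positivity), Real.norm_of_nonneg hpos]
      calc g ξ ≤ (2 ^ k * (1 + n ^ k)) * (1 + ∑ i, |ξ i| ^ (k + 1)) * ‖Fh ξ‖ :=
            mul_le_mul_of_nonneg_right b (norm_nonneg _)
        _ = A * (‖Fh ξ‖ + ∑ i, |ξ i| ^ (k + 1) * ‖Fh ξ‖) := by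
            rw [hA, ← Finset.sum_mul]; push_cast; ring
        _ ≤ _ := by
            gcongr with i
            exact hD i
    have p2 := eLpNorm_le_nnreal_smul_eLpNorm_of_ae_le_mul
      (Filter.Eventually.of_forall p1) (μ := volume) 2
    refine p2.trans ?_
    rw [ENNReal.smul_def, smul_eq_mul]
    gcongr
    have mD : ∀ i, AEStronglyMeasurable (fun ξ => ‖D i ξ‖) volume :=
      fun i => (fi i).1.norm.aestronglyMeasurable
    refine (eLpNorm_add_le f0.1.norm.aestronglyMeasurable
      (Finset.aestronglyMeasurable_fun_sum Finset.univ (fun i _ => mD i)) (by norm_num)).trans ?_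
    gcongr
    · rw [eLpNorm_norm]
      exact f0.2.le
    · have := eLpNorm_sum_le (s := Finset.univ) (f := fun i ξ => ‖D i ξ‖) (p := 2) (fun i _ => mD i)
        (by norm_num)
      have e : (∑ i, fun ξ => ‖D i ξ‖) = fun ξ => ∑ i, ‖D i ξ‖ := by ext; simp
      rw [e] at this
      refine this.trans (Finset.sum_le_sum fun i _ => ?_)
      rw [eLpNorm_norm]
      exact (fi i).2.le
  have hmul := eLpNorm_smul_le_mul_eLpNorm (p := 2) (q := 2) (r := 1) (μ := volume)
    hgc.aestronglyMeasurable hwc.aestronglyMeasurable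
  rw [eLpNorm_one_eq_lintegral_enorm] at hmul
  calc _ = ∫⁻ ξ, ‖(w • g) ξ‖ₑ := by
        refine lintegral_congr fun ξ => ?_
        have : (w • g) ξ = (1 + ‖ξ‖) ^ 2 * ‖Fh ξ‖ := by
          simp only [Pi.smul_apply', smul_eq_mul, w, g]
          rw [← mul_assoc, ← Real.rpow_natCast _ (k + 1), ← Real.rpow_add (by positivity),
            sub_add_cancel]
          norm_num
        rw [this, Real.enorm_of_nonneg (by positivity)]
    _ ≤ _ := hmul
    _ ≤ _ := by
        push_cast
        rw [hwn, mul_assoc]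
        gcongr

/-! ### Barron norms of superpositions and of Fourier integrals. -/

/-- A superposition of ridge functions over an arbitrary measure space has finite Barron norm as
soon as the natural cost integral is finite. -/
theorem barronNorm_le_lintegral {n : ℕ} {S : Set (EuclideanSpace ℝ (Fin n))}
    {f : EuclideanSpace ℝ (Fin n) → ℝ} {Y : Type*} [MeasurableSpace Y] (ν : Measure Y)
    {b : Y → EuclideanSpace ℝ (Fin n)} {c w : Y → ℝ} (hb : Measurable b) (hc : Measurable c)
    (hw : Measurable w)
    (hf : ∀ t ∈ S, f t = ∫ y, w y * max 0 (inner ℝ (b y) t + c y) ∂ν) :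
    barronNorm S f ≤ ∫⁻ y, ENNReal.ofReal (|w y| * (‖b y‖ + |c y|)) ∂ν := by
  set M := ∫⁻ y, ENNReal.ofReal (|w y| * (‖b y‖ + |c y|)) ∂ν with hM
  rcases eq_or_ne M ⊤ with hT | hT
  · rw [hT]; exact le_top
  have hmm : Measurable fun y => |w y| * (‖b y‖ + |c y|) := by fun_prop
  rcases eq_or_ne M 0 with h0 | h0
  · have hae : ∀ᵐ y ∂ν, |w y| * (‖b y‖ + |c y|) = 0 := by
      rw [hM, lintegral_eq_zero_iff hmm.ennreal_ofReal] at h0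
      filter_upwards [h0] with y hy
      exact le_antisymm (ENNReal.ofReal_eq_zero.mp hy) (by positivity)
    have hf0 : ∀ t ∈ S, f t = 0 := by
      intro t ht
      rw [hf t ht]
      refine integral_eq_zero_of_ae ?_
      filter_upwards [hae] with y hy
      rcases mul_eq_zero.mp hy with h | h
      · simp [abs_eq_zero.mp h]
      · have h1 : ‖b y‖ = 0 := by linarith [norm_nonneg (b y), abs_nonneg (c y)]
        have h2 : |c y| = 0 := by linarith [norm_nonneg (b y), abs_nonneg (c y)]
        simp [norm_eq_zero.mp h1, abs_eq_zero.mp h2]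
    -- A zero cost cannot be normalised to a probability density, but then f vanishes on S and a
    -- Dirac mass at the origin represents it.
    refine (iInf₂_le (Measure.dirac (0, 0, 0)) ⟨inferInstance, fun t ht => ⟨?_, ?_⟩⟩).trans ?_
    · rw [lintegral_dirac]; simp
    · exact integrable_dirac (by simp)
    · rw [hf0 t ht, integral_dirac]; simp
  set m : ℝ := M.toReal with hm
  have hmpos : 0 < m := ENNReal.toReal_pos h0 hT
  have hMm : M = ENNReal.ofReal m := (ENNReal.ofReal_toReal hT).symm
  let r : Y → ℝ := fun y => ‖b y‖ + |c y|
  have hr : Measurable r := by fun_prop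
  let δ : Y → ℝ := fun y => |w y| * r y / m
  have hδ : Measurable δ := (hmm.div_const m)
  have hδ0 : ∀ y, 0 ≤ δ y := fun y => by positivity
  let sg : Y → ℝ := fun y => if 0 ≤ w y then m else -m
  have hsg : Measurable sg := Measurable.ite (measurableSet_le measurable_const hw)
    measurable_const measurable_const
  have hsgabs : ∀ y, |sg y| = m := by
    intro y
    simp only [sg]
    split_ifs
    · exact abs_of_pos hmpos
    · rw [abs_neg, abs_of_pos hmpos]
  -- By positive homogeneity of the ReLU the inner parameters can be scaled to ‖b‖ + |c| = 1. Their
  -- size and |w| move into the density `δ`, which has mass one after division by m; the outer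
  -- weight becomes ±m.
  let Φ : Y → EuclideanSpace ℝ (Fin n) × ℝ × ℝ := fun y => ((r y)⁻¹ • b y, (r y)⁻¹ * c y, sg y)
  have hΦ : Measurable Φ := by fun_prop
  let κ : Measure Y := ν.withDensity fun y => ENNReal.ofReal (δ y)
  have hκ : κ Set.univ = 1 := by
    simp only [κ]
    rw [withDensity_apply _ MeasurableSet.univ, Measure.restrict_univ]
    have : ∀ y, ENNReal.ofReal (δ y) = ENNReal.ofReal (|w y| * (‖b y‖ + |c y|)) * (ENNReal.ofReal m)⁻¹ := by
      intro y
      rw [← ENNReal.ofReal_inv_of_pos hmpos, ← ENNReal.ofReal_mul (by positivity)]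
      rfl
    simp only [this]
    rw [lintegral_mul_const _ hmm.ennreal_ofReal, ← hM, ← hMm]
    exact ENNReal.mul_inv_cancel h0 hT
  have : IsProbabilityMeasure κ := ⟨hκ⟩
  have hΨ : ∀ t : EuclideanSpace ℝ (Fin n), Measurable
      fun p : EuclideanSpace ℝ (Fin n) × ℝ × ℝ => p.2.2 * max 0 (inner ℝ p.1 t + p.2.1) := by
    intro t
    fun_prop
  have hpt : ∀ t y, (δ y) * ((Φ y).2.2 * max 0 (inner ℝ (Φ y).1 t + (Φ y).2.1))
      = w y * max 0 (inner ℝ (b y) t + c y) := by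
    intro t y
    -- If `r y = 0`, then b and c vanish, so both sides are zero and the convention 0⁻¹ = 0 does no
    -- harm.
    rcases eq_or_lt_of_le (show 0 ≤ r y by positivity) with h | h
    · have h1 : ‖b y‖ = 0 := by linarith [norm_nonneg (b y), abs_nonneg (c y), show ‖b y‖ + |c y| = 0 from h.symm]
      have h2 : |c y| = 0 := by linarith [norm_nonneg (b y), abs_nonneg (c y), show ‖b y‖ + |c y| = 0 from h.symm]
      simp [Φ, norm_eq_zero.mp h1, abs_eq_zero.mp h2]
    · have e1 : inner ℝ ((r y)⁻¹ • b y) t + (r y)⁻¹ * c y = (r y)⁻¹ * (inner ℝ (b y) t + c y) := by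
        rw [real_inner_smul_left]; ring
      have e2 : |w y| * sg y = w y * m := by
        simp only [sg]
        split_ifs with hw0
        · rw [abs_of_nonneg hw0]
        · rw [abs_of_neg (not_le.mp hw0)]; ring
      simp only [Φ, δ]
      have e3 : max 0 ((r y)⁻¹ * (inner ℝ (b y) t + c y)) = (r y)⁻¹ * max 0 (inner ℝ (b y) t + c y) := by
        rw [mul_max_of_nonneg _ _ (inv_nonneg.mpr h.le), mul_zero]
      rw [e1, e3]
      calc _ = (|w y| * sg y) / m * (r y * (r y)⁻¹) * max 0 (inner ℝ (b y) t + c y) := by ring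
        _ = _ := by
          rw [e2, mul_inv_cancel₀ h.ne', mul_div_assoc, div_self hmpos.ne']; ring
  refine (iInf₂_le (κ.map Φ) ⟨Measure.isProbabilityMeasure_map hΦ.aemeasurable,
    fun t ht => ⟨?_, ?_⟩⟩).trans ?_
  · rw [lintegral_map (by fun_prop) hΦ]
    calc _ ≤ ∫⁻ _, ENNReal.ofReal m ∂κ := by
          refine lintegral_mono fun y => ENNReal.ofReal_le_ofReal ?_
          have : |(Φ y).2.2| = m := hsgabs y
          rw [this]
          refine mul_le_of_le_one_right hmpos.le ?_
          simp only [Φ, norm_smul, abs_mul, norm_inv, abs_inv, Real.norm_eq_abs]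
          rw [abs_of_nonneg (show 0 ≤ r y by positivity), ← mul_add, inv_mul_eq_div]
          exact div_self_le_one _
      _ = M := by rw [lintegral_const, hκ, mul_one, hMm]
  · rw [integrable_map_measure (hΨ t).aestronglyMeasurable hΦ.aemeasurable]
    refine Integrable.of_bound ((hΨ t).comp hΦ).aestronglyMeasurable (m * (‖t‖ + 1))
      (Filter.Eventually.of_forall fun y => ?_)
    simp only [Function.comp, norm_mul, Real.norm_eq_abs]
    gcongr
    · exact (hsgabs y).le
    · rw [abs_of_nonneg (le_max_left _ _)]
      refine max_le (by positivity) ?_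
      have h1 : ‖(Φ y).1‖ ≤ 1 := by
        simp only [Φ, norm_smul, norm_inv, Real.norm_eq_abs]
        rw [abs_of_nonneg (show 0 ≤ r y by positivity), inv_mul_eq_div]
        exact div_le_one_of_le₀ (by simp [r]) (by positivity)
      have h2 : |(Φ y).2.1| ≤ 1 := by
        simp only [Φ, abs_mul, abs_inv]
        rw [abs_of_nonneg (show 0 ≤ r y by positivity), inv_mul_eq_div]
        exact div_le_one_of_le₀ (by simp [r]) (by positivity)
      have h3 := real_inner_le_norm (Φ y).1 t
      have h4 := le_abs_self (Φ y).2.1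
      nlinarith [norm_nonneg t]
  · rw [integral_map hΦ.aemeasurable (hΨ t).aestronglyMeasurable, hf t ht]
    rw [integral_withDensity_eq_integral_toReal_smul hδ.ennreal_ofReal
      (Filter.Eventually.of_forall fun y => ENNReal.ofReal_lt_top)]
    refine integral_congr_ae (Filter.Eventually.of_forall fun y => ?_)
    simp only [smul_eq_mul]
    rw [ENNReal.toReal_ofReal (hδ0 y), hpt]

/-- The sum of two representing measures has mass two; `barronNorm_le_lintegral` accepts any measure
and takes care of the normalisation. -/
theorem barronNorm_add_le {n : ℕ} (S : Set (EuclideanSpace ℝ (Fin n)))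
    (f g : EuclideanSpace ℝ (Fin n) → ℝ) :
    barronNorm S (fun t => f t + g t) ≤ barronNorm S f + barronNorm S g := by
  refine ENNReal.le_iInf₂_add_iInf₂ fun ρ₁ h₁ ρ₂ h₂ => ?_
  rw [← lintegral_add_measure]
  refine barronNorm_le_lintegral (ρ₁ + ρ₂) (b := fun p => p.1) (c := fun p => p.2.1)
    (w := fun p => p.2.2) (by fun_prop) (by fun_prop) (by fun_prop) fun t ht => ?_
  rw [integral_add_measure (h₁.2 t ht).1 (h₂.2 t ht).1, ← (h₁.2 t ht).2, ← (h₂.2 t ht).2]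

/-- Taylor's formula at -R with integral remainder: the second derivative of exp(iz) is -exp(iz),
and the kernel max(0, z - s) vanishes for s > z, so the range of s can be the fixed interval [-R,
R]. -/
theorem exp_mul_I_eq_integral_relu {R z : ℝ} (hz : |z| ≤ R) :
    Complex.exp (z * Complex.I) = Complex.exp (-R * Complex.I)
      + Complex.I * Complex.exp (-R * Complex.I) * (z + R)
      - ∫ s in Set.Icc (-R) R, (max 0 (z - s) : ℝ) * Complex.exp (s * Complex.I) := by
  obtain ⟨hz1, hz2⟩ := abs_le.mp hz
  have hd : ∀ s : ℝ, HasDerivAt (fun s : ℝ => ((z : ℂ) - s) * (-Complex.I * Complex.exp (s * Complex.I))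
      - Complex.exp (s * Complex.I)) (((z - s : ℝ) : ℂ) * Complex.exp (s * Complex.I)) s := by
    intro s
    have h1 : HasDerivAt (fun s : ℝ => Complex.exp (s * Complex.I))
        (Complex.exp (s * Complex.I) * (1 * Complex.I)) s :=
      ((Complex.ofRealCLM.hasDerivAt (x := s)).mul_const Complex.I).cexp
    have h2 : HasDerivAt (fun s : ℝ => (z : ℂ) - s) (-1) s :=
      (Complex.ofRealCLM.hasDerivAt (x := s)).const_sub (z : ℂ)
    refine ((h2.mul (h1.const_mul (-Complex.I))).sub h1).congr_deriv ?_
    push_cast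
    linear_combination (-((z : ℂ) - s) * Complex.exp (s * Complex.I)) * Complex.I_sq
  have hI : ∫ s in Set.Icc (-R) R, ((max 0 (z - s) : ℝ) : ℂ) * Complex.exp (s * Complex.I)
      = ∫ s in (-R)..z, ((z - s : ℝ) : ℂ) * Complex.exp (s * Complex.I) := by
    rw [intervalIntegral.integral_of_le hz1, ← integral_Icc_eq_integral_Ioc]
    rw [setIntegral_eq_of_subset_of_forall_sdiff_eq_zero measurableSet_Icc
      (Set.Icc_subset_Icc_right hz2)]
    · refine setIntegral_congr_fun measurableSet_Icc fun s hs => ?_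
      rw [max_eq_right (sub_nonneg.mpr hs.2)]
    · intro s hs
      have : z < s := by
        by_contra h
        exact hs.2 ⟨hs.1.1, not_lt.mp h⟩
      rw [max_eq_left (by linarith)]
      simp
  rw [hI, intervalIntegral.integral_eq_sub_of_hasDerivAt (fun s _ => hd s)
    (by apply Continuous.intervalIntegrable; fun_prop)]
  push_cast
  ring

theorem barronNorm_congr {n : ℕ} {S : Set (EuclideanSpace ℝ (Fin n))}
    {f g : EuclideanSpace ℝ (Fin n) → ℝ} (h : ∀ t ∈ S, f t = g t) :
    barronNorm S f = barronNorm S g := by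
  have : ∀ ρ, IsBarronRepresentation S f ρ ↔ IsBarronRepresentation S g ρ := by
    intro ρ
    refine and_congr_right fun _ => forall₂_congr fun t ht => ?_
    rw [h t ht]
  simp only [barronNorm, this]

theorem norm_le_sqrt_of_mem_paramDomain {n : ℕ} {t : EuclideanSpace ℝ (Fin n)}
    (ht : t ∈ paramDomain n) : ‖t‖ ≤ √n := by
  rw [EuclideanSpace.norm_eq]
  refine Real.sqrt_le_sqrt ?_
  calc ∑ i, ‖t i‖ ^ 2 ≤ ∑ _i : Fin n, (1 : ℝ) := Finset.sum_le_sum fun i _ => by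
        have := ht i
        rw [Real.norm_of_nonneg this.1]
        nlinarith [this.1, this.2]
    _ = n := by simp

open FourierTransform in
-- On the cube |2πξ·t| ≤ R(ξ) = 2π√n‖ξ‖, so the ReLU form of Taylor's formula applies under the
-- inversion integral. The constant, linear and remainder terms cost at most 1, B‖ξ‖ and 2B²‖ξ‖²
-- times |F̂(ξ)|.
theorem barronNorm_le_lintegral_fourier (n : ℕ) :
    ∃ C : ℝ≥0, ∀ F : EuclideanSpace ℝ (Fin n) → ℝ, Continuous F → HasCompactSupport F →
      barronNorm (paramDomain n) F ≤
        C * ∫⁻ ξ, ENNReal.ofReal ((1 + ‖ξ‖) ^ 2 * ‖𝓕 (fun x => (F x : ℂ)) ξ‖) := by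
  -- Chosen so that B‖ξ‖ = 2π‖ξ‖ + R(ξ), which bounds ‖b‖ + |c| for the inner weight b = 2πξ and any
  -- bias |c| ≤ R(ξ).
  set B : ℝ := 2 * Real.pi * (1 + √n) with hB
  have hB0 : 0 ≤ B := by positivity
  refine ⟨1 + B.toNNReal + (2 * B ^ 2).toNNReal, fun F hF hFc => ?_⟩
  set H := 𝓕 (fun x => (F x : ℂ)) with hH
  set J := ∫⁻ ξ, ENNReal.ofReal ((1 + ‖ξ‖) ^ 2 * ‖H ξ‖) with hJ
  rcases eq_or_ne J ⊤ with hT | hT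
  · rw [hT, ENNReal.mul_top]
    · exact le_top
    · positivity
  have hFi : Integrable fun x => (F x : ℂ) :=
    (hF.integrable_of_hasCompactSupport hFc).ofReal
  have hHc : Continuous H :=
    VectorFourier.fourierIntegral_continuous Real.continuous_fourierChar
      (by exact continuous_inner) hFi
  have hI2 : Integrable fun ξ => (1 + ‖ξ‖) ^ 2 * ‖H ξ‖ := by
    refine ⟨by fun_prop, ?_⟩
    rw [hasFiniteIntegral_iff_ofReal (Filter.Eventually.of_forall fun ξ => by positivity)]
    exact hT.lt_top
  have hHi : Integrable H := by
    refine hI2.mono hHc.aestronglyMeasurable (Filter.Eventually.of_forall fun ξ => ?_)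
    rw [Real.norm_of_nonneg (by positivity)]
    exact le_mul_of_one_le_left (norm_nonneg _) (by nlinarith [norm_nonneg ξ])
  let R : EuclideanSpace ℝ (Fin n) → ℝ := fun ξ => 2 * Real.pi * √n * ‖ξ‖
  have hRc : Continuous R := by fun_prop
  have hR0 : ∀ ξ, 0 ≤ R ξ := fun ξ => by positivity
  have hRB : ∀ ξ, 2 * Real.pi * ‖ξ‖ + R ξ = B * ‖ξ‖ := fun ξ => by simp only [R, hB]; ring
  let w₁ : EuclideanSpace ℝ (Fin n) → ℝ := fun ξ => (H ξ * Complex.exp (-R ξ * Complex.I)).re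
  let w₂ : EuclideanSpace ℝ (Fin n) → ℝ :=
    fun ξ => (H ξ * (Complex.I * Complex.exp (-R ξ * Complex.I))).re
  let w₃ : EuclideanSpace ℝ (Fin n) × ℝ → ℝ :=
    fun p => if |p.2| ≤ R p.1 then -(H p.1 * Complex.exp (p.2 * Complex.I)).re else 0
  have hw₁ : Continuous w₁ := by fun_prop
  have hw₂ : Continuous w₂ := by fun_prop
  have hw₃ : Measurable w₃ := Measurable.ite (measurableSet_le (by fun_prop) (by fun_prop))
    (by apply Continuous.measurable; fun_prop) measurable_const
  have hexp : ∀ x : ℝ, ‖Complex.exp (x * Complex.I)‖ = 1 := Complex.norm_exp_ofReal_mul_I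
  have bw₁ : ∀ ξ, |w₁ ξ| ≤ ‖H ξ‖ := fun ξ => by
    refine (Complex.abs_re_le_norm _).trans ?_
    rw [norm_mul, ← Complex.ofReal_neg, hexp, mul_one]
  have bw₂ : ∀ ξ, |w₂ ξ| ≤ ‖H ξ‖ := fun ξ => by
    refine (Complex.abs_re_le_norm _).trans ?_
    rw [norm_mul, norm_mul, Complex.norm_I, one_mul, ← Complex.ofReal_neg, hexp, mul_one]
  have bw₃ : ∀ ξ s, |w₃ (ξ, s)| ≤ (Set.Icc (-R ξ) (R ξ)).indicator (fun _ => ‖H ξ‖) s := by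
    intro ξ s
    simp only [w₃]
    split_ifs with h
    · have hmem : s ∈ Set.Icc (-R ξ) (R ξ) := abs_le.mp h
      rw [Set.indicator_of_mem hmem, abs_neg]
      refine (Complex.abs_re_le_norm _).trans ?_
      rw [norm_mul, hexp, mul_one]
    · rw [abs_zero]
      exact Set.indicator_nonneg (fun _ _ => norm_nonneg _) _
  let b₃ : EuclideanSpace ℝ (Fin n) × ℝ → EuclideanSpace ℝ (Fin n) := fun p => (2 * Real.pi) • p.1
  -- The constant term uses σ(0·t + 1) = 1. The linear term uses that 2πξ·t + R(ξ) is nonnegative on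
  -- the cube, where σ is the identity. The remainder is a superposition over pairs (ξ, s) with |s|
  -- ≤ R(ξ).
  let f₁ : EuclideanSpace ℝ (Fin n) → ℝ := fun t => ∫ ξ, w₁ ξ * max 0 (inner ℝ (0 : EuclideanSpace ℝ (Fin n)) t + 1)
  let f₂ : EuclideanSpace ℝ (Fin n) → ℝ := fun t => ∫ ξ, w₂ ξ * max 0 (inner ℝ ((2 * Real.pi) • ξ) t + R ξ)
  let f₃ : EuclideanSpace ℝ (Fin n) → ℝ := fun t => ∫ p, w₃ p * max 0 (inner ℝ (b₃ p) t + (-p.2)) ∂(volume.prod volume)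
  have cost₁ : barronNorm (paramDomain n) f₁ ≤ J := by
    refine (barronNorm_le_lintegral (volume : Measure (EuclideanSpace ℝ (Fin n)))
      (b := fun _ => 0) (c := fun _ => 1) (w := w₁) measurable_const measurable_const
      hw₁.measurable (fun t _ => rfl)).trans ?_
    refine lintegral_mono fun ξ => ENNReal.ofReal_le_ofReal ?_
    have := bw₁ ξ
    simp only [norm_zero, abs_one, zero_add, mul_one]
    refine this.trans (le_mul_of_one_le_left (norm_nonneg _) (by nlinarith [norm_nonneg ξ]))
  have cost₂ : barronNorm (paramDomain n) f₂ ≤ B.toNNReal * J := by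
    refine (barronNorm_le_lintegral (volume : Measure (EuclideanSpace ℝ (Fin n)))
      (b := fun ξ => (2 * Real.pi) • ξ) (c := R) (w := w₂) (by fun_prop) hRc.measurable
      hw₂.measurable (fun t _ => rfl)).trans ?_
    rw [hJ, ← lintegral_const_mul' _ _ ENNReal.coe_ne_top]
    refine lintegral_mono fun ξ => ?_
    rw [← ENNReal.ofReal, ← ENNReal.ofReal_mul hB0]
    refine ENNReal.ofReal_le_ofReal ?_
    have h1 : ‖(2 * Real.pi) • ξ‖ + |R ξ| = B * ‖ξ‖ := by
      rw [norm_smul, Real.norm_of_nonneg (by positivity), abs_of_nonneg (hR0 ξ), hRB]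
    rw [h1]
    calc |w₂ ξ| * (B * ‖ξ‖) ≤ ‖H ξ‖ * (B * ‖ξ‖) := by gcongr; exact bw₂ ξ
      _ = B * (‖ξ‖ * ‖H ξ‖) := by ring
      _ ≤ _ := by gcongr; nlinarith [norm_nonneg ξ]
  have hcost₃ : ∫⁻ p, ENNReal.ofReal (|w₃ p| * (‖b₃ p‖ + |(-p.2)|)) ∂(volume.prod volume)
      ≤ (2 * B ^ 2).toNNReal * J := by
    rw [lintegral_prod _ (by fun_prop)]
    rw [hJ, ← lintegral_const_mul' _ _ ENNReal.coe_ne_top]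
    refine lintegral_mono fun ξ => ?_
    calc ∫⁻ s, ENNReal.ofReal (|w₃ (ξ, s)| * (‖b₃ (ξ, s)‖ + |(-s)|))
        ≤ ∫⁻ s, (Set.Icc (-R ξ) (R ξ)).indicator
            (fun _ => ENNReal.ofReal (‖H ξ‖ * (B * ‖ξ‖))) s := by
          refine lintegral_mono fun s => ?_
          have := bw₃ ξ s
          by_cases hs : s ∈ Set.Icc (-R ξ) (R ξ)
          · rw [Set.indicator_of_mem hs] at this ⊢
            refine ENNReal.ofReal_le_ofReal ?_
            gcongr
            simp only [b₃]
            rw [norm_smul, Real.norm_of_nonneg (by positivity), abs_neg, ← hRB]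
            gcongr
            exact abs_le.mpr hs
          · rw [Set.indicator_of_notMem hs] at this ⊢
            simp [abs_nonpos_iff.mp this]
      _ = ENNReal.ofReal (‖H ξ‖ * (B * ‖ξ‖)) * ENNReal.ofReal (2 * R ξ) := by
          rw [lintegral_indicator_const measurableSet_Icc, Real.volume_Icc]
          congr 2
          ring
      _ ≤ _ := by
          rw [← ENNReal.ofReal_mul (by positivity), ← ENNReal.ofReal,
            ← ENNReal.ofReal_mul (by positivity)]
          refine ENNReal.ofReal_le_ofReal ?_
          have h1 : R ξ ≤ B * ‖ξ‖ := by
            rw [← hRB]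
            have : 0 ≤ 2 * Real.pi * ‖ξ‖ := by positivity
            linarith
          calc _ ≤ ‖H ξ‖ * (B * ‖ξ‖) * (2 * (B * ‖ξ‖)) := by gcongr
            _ = 2 * B ^ 2 * (‖ξ‖ ^ 2 * ‖H ξ‖) := by ring
            _ ≤ _ := by gcongr; linarith
  have cost₃ : barronNorm (paramDomain n) f₃ ≤ (2 * B ^ 2).toNNReal * J :=
    (barronNorm_le_lintegral (volume.prod volume)
      (b := b₃) (c := fun p => -p.2) (w := w₃) (by fun_prop) (by fun_prop)
      hw₃ (fun t _ => rfl)).trans hcost₃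
  have hsum : ∀ t ∈ paramDomain n, F t = f₁ t + f₂ t + f₃ t := by
    intro t ht
    have hz : ∀ ξ, |2 * Real.pi * inner ℝ ξ t| ≤ R ξ := by
      intro ξ
      rw [abs_mul, abs_of_nonneg (by positivity : (0 : ℝ) ≤ 2 * Real.pi)]
      have h1 := abs_real_inner_le_norm ξ t
      have h2 := norm_le_sqrt_of_mem_paramDomain ht
      calc _ ≤ 2 * Real.pi * (‖ξ‖ * √n) := by gcongr; exact h1.trans (by gcongr)
        _ = R ξ := by simp only [R]; ring
    have e1 : ∀ ξ, w₁ ξ * max 0 (inner ℝ (0 : EuclideanSpace ℝ (Fin n)) t + 1) = w₁ ξ := by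
      intro ξ; simp
    have e2 : ∀ ξ, w₂ ξ * max 0 (inner ℝ ((2 * Real.pi) • ξ) t + R ξ)
        = w₂ ξ * (2 * Real.pi * inner ℝ ξ t + R ξ) := by
      intro ξ
      rw [real_inner_smul_left, max_eq_right]
      linarith [(abs_le.mp (hz ξ)).1]
    have i1 : Integrable w₁ := by
      refine hHi.mono hw₁.aestronglyMeasurable (Filter.Eventually.of_forall fun ξ => bw₁ ξ)
    have i2 : Integrable fun ξ => w₂ ξ * (2 * Real.pi * inner ℝ ξ t + R ξ) := by
      refine (hI2.const_mul (2 * B)).mono (by fun_prop) (Filter.Eventually.of_forall fun ξ => ?_)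
      have h1 : |2 * Real.pi * inner ℝ ξ t + R ξ| ≤ 2 * (B * ‖ξ‖) := by
        have := abs_le.mp (hz ξ)
        have h1 : R ξ ≤ B * ‖ξ‖ := by
          rw [← hRB]
          have : 0 ≤ 2 * Real.pi * ‖ξ‖ := by positivity
          linarith
        rw [abs_le]
        constructor <;> linarith
      rw [norm_mul, Real.norm_eq_abs, Real.norm_eq_abs, Real.norm_of_nonneg (by positivity)]
      calc _ ≤ ‖H ξ‖ * (2 * (B * ‖ξ‖)) := by gcongr; exact bw₂ ξ
        _ = 2 * B * (‖ξ‖ * ‖H ξ‖) := by ring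
        _ ≤ _ := by gcongr; nlinarith [norm_nonneg ξ]
    have i3 : Integrable (fun p => w₃ p * max 0 (inner ℝ (b₃ p) t + (-p.2))) (volume.prod volume) := by
      -- The cost density is integrable and, times ‖t‖ + 1, dominates the integrand; this permits
      -- Fubini in (ξ, s).
      have m3 : Integrable (fun p : EuclideanSpace ℝ (Fin n) × ℝ => |w₃ p| * (‖b₃ p‖ + |(-p.2)|)) (volume.prod volume) := by
        refine ⟨by apply Measurable.aestronglyMeasurable; fun_prop, ?_⟩
        rw [hasFiniteIntegral_iff_ofReal (Filter.Eventually.of_forall fun ξ => by positivity)]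
        exact hcost₃.trans_lt (ENNReal.mul_lt_top ENNReal.coe_lt_top hT.lt_top)
      refine (m3.const_mul (‖t‖ + 1)).mono (by apply Measurable.aestronglyMeasurable; fun_prop)
        (Filter.Eventually.of_forall fun p => ?_)
      refine le_trans ?_ (Real.le_norm_self _)
      rw [norm_mul, Real.norm_of_nonneg (le_max_left _ _), Real.norm_eq_abs]
      have : max 0 (inner ℝ (b₃ p) t + (-p.2)) ≤ (‖t‖ + 1) * (‖b₃ p‖ + |(-p.2)|) := by
        refine max_le (by positivity) ?_
        have h3 := real_inner_le_norm (b₃ p) t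
        have h4 := le_abs_self (-p.2)
        nlinarith [norm_nonneg t, norm_nonneg (b₃ p), abs_nonneg (-p.2),
          mul_nonneg (norm_nonneg t) (abs_nonneg (-p.2))]
      calc _ ≤ |w₃ p| * ((‖t‖ + 1) * (‖b₃ p‖ + |(-p.2)|)) := by gcongr
        _ = _ := by ring
    have e3 : ∀ ξ, ∫ s, w₃ (ξ, s) * max 0 (inner ℝ (b₃ (ξ, s)) t + (-s))
        = -(H ξ * ∫ s in Set.Icc (-R ξ) (R ξ), (max 0 (2 * Real.pi * inner ℝ ξ t - s) : ℝ)
            * Complex.exp (s * Complex.I)).re := by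
      intro ξ
      rw [← integral_const_mul, ← Complex.reCLM_apply, ← ContinuousLinearMap.integral_comp_comm,
        ← integral_neg, ← integral_indicator measurableSet_Icc]
      · refine integral_congr_ae (Filter.Eventually.of_forall fun s => ?_)
        simp only [w₃, b₃]
        split_ifs with h
        · have hmem : s ∈ Set.Icc (-R ξ) (R ξ) := abs_le.mp h
          rw [Set.indicator_of_mem hmem, real_inner_smul_left, ← sub_eq_add_neg,
            Complex.reCLM_apply, mul_left_comm, Complex.re_ofReal_mul]
          ring
        · have hmem : s ∉ Set.Icc (-R ξ) (R ξ) := fun h' => h (abs_le.mpr h')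
          rw [Set.indicator_of_notMem hmem, zero_mul]
      · refine ContinuousOn.integrableOn_Icc ?_
        fun_prop
    have hFt : F t = (∫ ξ, H ξ * Complex.exp ((2 * Real.pi * inner ℝ ξ t : ℝ) * Complex.I)).re := by
      have := congrFun (Continuous.fourierInv_fourier_eq (f := fun x => (F x : ℂ)) (by fun_prop) hFi hHi) t
      rw [Real.fourierInv_eq'] at this
      have h2 := congrArg Complex.re this
      rw [Complex.ofReal_re] at h2
      rw [← h2]
      congr 1
      refine integral_congr_ae (Filter.Eventually.of_forall fun ξ => ?_)
      simp only [smul_eq_mul]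
      rw [mul_comm]
    rw [hFt, ← Complex.reCLM_apply, ← ContinuousLinearMap.integral_comp_comm]
    · simp only [f₁, f₂, f₃]
      rw [integral_prod _ i3]
      simp only [e1, e2]
      have i12 : Integrable fun ξ => w₁ ξ + w₂ ξ * (2 * Real.pi * inner ℝ ξ t + R ξ) := i1.add i2
      have i3' : Integrable fun ξ => ∫ s, w₃ (ξ, s) * max 0 (inner ℝ (b₃ (ξ, s)) t + -s) :=
        i3.integral_prod_left
      rw [← integral_add i1 i2, ← integral_add i12 i3']
      refine integral_congr_ae (Filter.Eventually.of_forall fun ξ => ?_)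
      beta_reduce
      rw [e3, exp_mul_I_eq_integral_relu (hz ξ), Complex.reCLM_apply, mul_sub, mul_add,
        Complex.sub_re, Complex.add_re]
      simp only [w₁, w₂]
      rw [sub_eq_add_neg, ← mul_assoc, mul_comm _ (((2 * Real.pi * inner ℝ ξ t : ℝ) : ℂ) + R ξ),
        ← Complex.ofReal_add, Complex.re_ofReal_mul]
      ring
    · refine hHi.mono (by fun_prop) (Filter.Eventually.of_forall fun ξ => ?_)
      rw [norm_mul, hexp, mul_one]
  rw [barronNorm_congr hsum]
  refine (barronNorm_add_le _ _ _).trans ((add_le_add_left (barronNorm_add_le _ _ _) _).trans ?_)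
  push_cast
  rw [add_mul, add_mul, one_mul]
  exact add_le_add (add_le_add cost₁ cost₂) cost₃

/-! ### Extension across hyperplanes by higher-order reflection. -/

/-- The affine map which scales the coordinate `s * x i + a` by the factor `ν` (when `s ^ 2 = 1`)
and keeps the other coordinates. -/
noncomputable def scaleCoord {n : ℕ} (i : Fin n) (s a ν : ℝ) (x : EuclideanSpace ℝ (Fin n)) :
    EuclideanSpace ℝ (Fin n) :=
  x + ((ν - 1) * s * (s * x i + a)) • EuclideanSpace.single i 1

/-- Extension of a function from the half space `0 ≤ s * x i + a` by the weighted sum of its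
rescaled reflections. -/
noncomputable def reflectExt {n M : ℕ} (i : Fin n) (s a : ℝ) (ν c : Fin M → ℝ)
    (G : EuclideanSpace ℝ (Fin n) → ℝ) (x : EuclideanSpace ℝ (Fin n)) : ℝ :=
  if 0 ≤ s * x i + a then G x else ∑ k, c k * G (scaleCoord i s a (ν k) x)

theorem scaleCoord_apply_same {n : ℕ} {i : Fin n} {s : ℝ} (hs : s * s = 1) (a ν : ℝ)
    (x : EuclideanSpace ℝ (Fin n)) :
    s * scaleCoord i s a ν x i + a = ν * (s * x i + a) := by
  simp only [scaleCoord, PiLp.add_apply, PiLp.smul_apply, PiLp.single_apply, if_true,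
    smul_eq_mul, mul_one]
  linear_combination ((ν - 1) * (s * x i + a)) * hs

theorem scaleCoord_apply_of_ne {n : ℕ} {i j : Fin n} (hj : j ≠ i) (s a ν : ℝ)
    (x : EuclideanSpace ℝ (Fin n)) : scaleCoord i s a ν x j = x j := by
  simp [scaleCoord, hj]

theorem scaleCoord_of_eq_zero {n : ℕ} {i : Fin n} {s a : ℝ} (ν : ℝ)
    {x : EuclideanSpace ℝ (Fin n)} (hx : s * x i + a = 0) : scaleCoord i s a ν x = x := by
  simp [scaleCoord, hx]

/-- The linear part of `scaleCoord`. -/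
noncomputable def scaleCoordLinear {n : ℕ} (i : Fin n) (ν : ℝ) :
    EuclideanSpace ℝ (Fin n) →L[ℝ] EuclideanSpace ℝ (Fin n) :=
  ContinuousLinearMap.id ℝ _ + (ν - 1) •
    (EuclideanSpace.proj i : EuclideanSpace ℝ (Fin n) →L[ℝ] ℝ).smulRight (EuclideanSpace.single i 1)

theorem scaleCoordLinear_apply {n : ℕ} (i : Fin n) (ν : ℝ) (v : EuclideanSpace ℝ (Fin n))
    (k : Fin n) : scaleCoordLinear i ν v k = (if k = i then ν else 1) * v k := by
  by_cases h : k = i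
  · subst h
    simp [scaleCoordLinear]
    ring
  · simp [scaleCoordLinear, h]

theorem scaleCoordLinear_single {n : ℕ} (i j : Fin n) (ν : ℝ) :
    scaleCoordLinear i ν (EuclideanSpace.single j 1)
      = (if j = i then ν else 1) • EuclideanSpace.single j (1 : ℝ) := by
  ext k
  rw [scaleCoordLinear_apply, PiLp.smul_apply, PiLp.single_apply, smul_eq_mul]
  by_cases h : k = j
  · rw [h]
  · simp [h]

theorem scaleCoord_eq {n : ℕ} {i : Fin n} {s : ℝ} (hs : s * s = 1) (a ν : ℝ)
    (x : EuclideanSpace ℝ (Fin n)) :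
    scaleCoord i s a ν x = scaleCoordLinear i ν x
      + ((ν - 1) * s * a) • EuclideanSpace.single i (1 : ℝ) := by
  ext k
  rw [PiLp.add_apply, scaleCoordLinear_apply]
  by_cases h : k = i
  · subst h
    simp [scaleCoord]
    linear_combination ((ν - 1) * x k) * hs
  · simp [scaleCoord, h]

theorem hasFDerivAt_scaleCoord {n : ℕ} {i : Fin n} {s : ℝ} (hs : s * s = 1) (a ν : ℝ)
    (x : EuclideanSpace ℝ (Fin n)) :
    HasFDerivAt (scaleCoord i s a ν) (scaleCoordLinear i ν) x := by
  have : scaleCoord i s a ν = fun x => scaleCoordLinear i ν x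
      + ((ν - 1) * s * a) • EuclideanSpace.single i (1 : ℝ) := funext (scaleCoord_eq hs a ν)
  rw [this]
  exact (scaleCoordLinear i ν).hasFDerivAt.add_const _

theorem clm_eq_sum_proj {n : ℕ} (L : EuclideanSpace ℝ (Fin n) →L[ℝ] ℝ) :
    L = ∑ j, L (EuclideanSpace.single j 1) • EuclideanSpace.proj j := by
  ext v
  conv_lhs => rw [← (EuclideanSpace.basisFun (Fin n) ℝ).sum_repr v]
  simp [mul_comm]

@[fun_prop]
theorem continuous_scaleCoord {n : ℕ} (i : Fin n) (s a ν : ℝ) : Continuous (scaleCoord i s a ν) := by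
  unfold scaleCoord
  fun_prop

theorem continuous_reflectExt {n M : ℕ} (i : Fin n) (s a : ℝ) {ν c : Fin M → ℝ}
    (hc : ∑ k, c k = 1) {G : EuclideanSpace ℝ (Fin n) → ℝ} (hG : Continuous G) :
    Continuous (reflectExt i s a ν c G) := by
  unfold reflectExt
  refine Continuous.if_le hG (by fun_prop) continuous_const (by fun_prop) fun x hx => ?_
  simp only [scaleCoord_of_eq_zero _ hx.symm]
  rw [← Finset.sum_mul, hc, one_mul]

/-- The coefficients of the reflection extension which a derivative in direction `j` produces. -/
noncomputable def derivCoeff {n M : ℕ} (i j : Fin n) (ν c : Fin M → ℝ) : Fin M → ℝ :=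
  fun k => c k * if j = i then ν k else 1

/-- The condition Σ c_k = 1 matches values and tangential derivatives on the hyperplane, Σ c_k ν_k =
1 the normal derivative. The partial derivatives are again reflection extensions, which makes
induction on the order possible. -/
theorem hasFDerivAt_reflectExt {n M : ℕ} (i : Fin n) {s : ℝ} (hs : s * s = 1) (a : ℝ)
    {ν c : Fin M → ℝ} (hc : ∑ k, c k = 1) (hc1 : ∑ k, c k * ν k = 1)
    {G : EuclideanSpace ℝ (Fin n) → ℝ} (hG : Differentiable ℝ G) (x : EuclideanSpace ℝ (Fin n)) :
    HasFDerivAt (reflectExt i s a ν c G)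
      (∑ j, reflectExt i s a ν (derivCoeff i j ν c) (partialDeriv j G) x •
        (EuclideanSpace.proj j : EuclideanSpace ℝ (Fin n) →L[ℝ] ℝ)) x := by
  set L : EuclideanSpace ℝ (Fin n) →L[ℝ] ℝ := ∑ j, reflectExt i s a ν (derivCoeff i j ν c) (partialDeriv j G) x •
        (EuclideanSpace.proj j : EuclideanSpace ℝ (Fin n) →L[ℝ] ℝ) with hL
  have hsum : ∀ j, ∑ k, derivCoeff i j ν c k = 1 := by
    intro j
    by_cases h : j = i <;> simp [derivCoeff, h, hc, hc1]
  have hp : Continuous fun x : EuclideanSpace ℝ (Fin n) => s * x i + a := by fun_prop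
  have h1 : 0 ≤ s * x i + a → HasFDerivAt G L x := by
    intro h
    convert (hG x).hasFDerivAt using 1
    rw [clm_eq_sum_proj (fderiv ℝ G x), hL]
    refine Finset.sum_congr rfl fun j _ => ?_
    simp [reflectExt, h, partialDeriv]
  have h2 : s * x i + a ≤ 0 →
      HasFDerivAt (fun x => ∑ k, c k * G (scaleCoord i s a (ν k) x)) L x := by
    intro h
    have : HasFDerivAt (fun x => ∑ k, c k * G (scaleCoord i s a (ν k) x))
        (∑ k, c k • (fderiv ℝ G (scaleCoord i s a (ν k) x)).comp (scaleCoordLinear i (ν k))) x := by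
      refine HasFDerivAt.fun_sum fun k _ => HasFDerivAt.const_mul ?_ (c k)
      exact (hG _).hasFDerivAt.comp x (hasFDerivAt_scaleCoord hs a (ν k) x)
    convert this using 1
    rw [clm_eq_sum_proj (∑ k, c k • (fderiv ℝ G (scaleCoord i s a (ν k) x)).comp
      (scaleCoordLinear i (ν k))), hL]
    refine Finset.sum_congr rfl fun j _ => ?_
    congr 1
    have e : (∑ k, c k • (fderiv ℝ G (scaleCoord i s a (ν k) x)).comp
      (scaleCoordLinear i (ν k))) (EuclideanSpace.single j 1)
        = ∑ k, derivCoeff i j ν c k * partialDeriv j G (scaleCoord i s a (ν k) x) := by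
      rw [_root_.sum_apply]
      refine Finset.sum_congr rfl fun k _ => ?_
      simp only [_root_.smul_apply, ContinuousLinearMap.comp_apply,
        scaleCoordLinear_single, map_smul, smul_eq_mul, derivCoeff, partialDeriv]
      ring
    rw [e]
    rcases h.lt_or_eq with h | h
    · simp [reflectExt, not_le.mpr h]
    · simp only [scaleCoord_of_eq_zero _ h, ← Finset.sum_mul, hsum]
      simp [reflectExt, h.ge]
  rcases lt_trichotomy (s * x i + a) 0 with h | h | h
  · refine (h2 h.le).congr_of_eventuallyEq ?_
    filter_upwards [(isOpen_lt hp continuous_const).mem_nhds h] with y hy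
    simp only [reflectExt, not_le.mpr (show s * y i + a < 0 from hy), if_false]
  · have w1 : HasFDerivWithinAt (reflectExt i s a ν c G) L {y | 0 ≤ s * y i + a} x := by
      refine (h1 h.ge).hasFDerivWithinAt.congr (fun y hy => ?_) ?_
      · exact if_pos hy
      · exact if_pos h.ge
    have w2 : HasFDerivWithinAt (reflectExt i s a ν c G) L {y | s * y i + a ≤ 0} x := by
      have key : ∀ y : EuclideanSpace ℝ (Fin n), s * y i + a ≤ 0 →
          reflectExt i s a ν c G y = ∑ k, c k * G (scaleCoord i s a (ν k) y) := by
        intro y hy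
        rcases hy.lt_or_eq with hy | hy
        · exact if_neg (not_le.mpr hy)
        · simp only [scaleCoord_of_eq_zero _ hy, ← Finset.sum_mul, hc, one_mul]
          exact if_pos hy.ge
      exact (h2 h.le).hasFDerivWithinAt.congr (fun y hy => key y hy) (key x h.le)
    -- The derivatives from the two closed half spaces coincide, and together these cover the space.
    have := w1.union w2
    rw [← hasFDerivWithinAt_univ]
    convert this
    ext y
    simpa using le_total _ _
  · refine (h1 h.le).congr_of_eventuallyEq ?_
    filter_upwards [(isOpen_lt continuous_const hp).mem_nhds h] with y hy
    simp only [reflectExt, (show 0 < s * y i + a from hy).le, if_true]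

theorem partialDeriv_reflectExt {n M : ℕ} (i j : Fin n) {s : ℝ} (hs : s * s = 1) (a : ℝ)
    {ν c : Fin M → ℝ} (hc : ∑ k, c k = 1) (hc1 : ∑ k, c k * ν k = 1)
    {G : EuclideanSpace ℝ (Fin n) → ℝ} (hG : Differentiable ℝ G) :
    partialDeriv j (reflectExt i s a ν c G)
      = reflectExt i s a ν (derivCoeff i j ν c) (partialDeriv j G) := by
  ext x
  simp only [partialDeriv]
  rw [(hasFDerivAt_reflectExt i hs a hc hc1 hG x).fderiv, _root_.sum_apply]
  simp

/-- A normal derivative multiplies c_k by ν_k and so shifts the moments by one; each derivative uses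
up one moment condition, just as it uses up one order of smoothness. -/
theorem sum_derivCoeff {n M : ℕ} (i j : Fin n) {ν c : Fin M → ℝ} {m : ℕ}
    (hc : ∀ b ≤ m + 1, ∑ k, c k * ν k ^ b = 1) :
    ∀ b ≤ m, ∑ k, derivCoeff i j ν c k * ν k ^ b = 1 := by
  intro b hb
  by_cases h : j = i
  · rw [← hc (b + 1) (by omega)]
    simp only [derivCoeff, h, if_true]
    exact Finset.sum_congr rfl fun k _ => by ring
  · rw [← hc b (by omega)]
    simp [derivCoeff, h]

theorem contDiff_reflectExt {n M : ℕ} (i : Fin n) {s : ℝ} (hs : s * s = 1) (a : ℝ)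
    {ν : Fin M → ℝ} (m : ℕ) {c : Fin M → ℝ} (hc : ∀ b ≤ m, ∑ k, c k * ν k ^ b = 1)
    {G : EuclideanSpace ℝ (Fin n) → ℝ} (hG : ContDiff ℝ m G) :
    ContDiff ℝ m (reflectExt i s a ν c G) := by
  induction m generalizing c G with
  | zero =>
    simp only [Nat.cast_zero, contDiff_zero] at hG ⊢
    exact continuous_reflectExt i s a (by simpa using hc 0 le_rfl) hG
  | succ m ih =>
    have hGd : Differentiable ℝ G := hG.differentiable (by simp)
    have hc0 : ∑ k, c k = 1 := by simpa using hc 0 (by omega)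
    have hc1 : ∑ k, c k * ν k = 1 := by simpa using hc 1 (by omega)
    have hd := hasFDerivAt_reflectExt i hs a hc0 hc1 hGd
    have hm : (((m + 1 : ℕ) : ℕ∞) : WithTop ℕ∞) = (m : WithTop ℕ∞) + 1 := by norm_cast
    refine (contDiff_succ_iff_hasFDerivAt (n := m)).mpr ⟨_, ?_, hd⟩
    refine ContDiff.sum fun j _ => ContDiff.smul (ih (sum_derivCoeff i j hc) ?_) contDiff_const
    exact ContDiff.partialDeriv (m := m) (by exact_mod_cast hG) j

theorem iterate_partialDeriv_reflectExt {n M : ℕ} (i j : Fin n) {s : ℝ} (hs : s * s = 1) (a : ℝ)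
    {ν : Fin M → ℝ} (m : ℕ) {l : ℕ} (hml : m ≤ l) {c : Fin M → ℝ}
    (hc : ∀ b ≤ l, ∑ k, c k * ν k ^ b = 1)
    {G : EuclideanSpace ℝ (Fin n) → ℝ} (hG : ContDiff ℝ l G) :
    (partialDeriv j)^[m] (reflectExt i s a ν c G)
      = reflectExt i s a ν ((derivCoeff i j ν)^[m] c) ((partialDeriv j)^[m] G) := by
  induction m generalizing c G l with
  | zero => rfl
  | succ m ih =>
    obtain ⟨l, rfl⟩ : ∃ l', l = l' + 1 := ⟨l - 1, by omega⟩
    have hc0 : ∑ k, c k = 1 := by simpa using hc 0 (by omega)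
    have hc1 : ∑ k, c k * ν k = 1 := by simpa using hc 1 (by omega)
    rw [Function.iterate_succ_apply, Function.iterate_succ_apply, Function.iterate_succ_apply,
      partialDeriv_reflectExt i j hs a hc0 hc1 (hG.differentiable (by simp))]
    exact ih (l := l) (by omega) (sum_derivCoeff i j hc)
      (ContDiff.partialDeriv (m := l) (by exact_mod_cast hG) j)

/-- The moment conditions form a transposed Vandermonde system, solvable for distinct nodes. The
nodes -(k+1)/(l+1) lie in [-1, 0), so points within distance one beyond a face are reflected to
within distance one inside it. -/
theorem exists_reflection_coeff (l : ℕ) : ∃ ν c : Fin (l + 1) → ℝ,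
    (∀ k, -1 ≤ ν k ∧ ν k < 0) ∧ ∀ b ≤ l, ∑ k, c k * ν k ^ b = 1 := by
  let ν : Fin (l + 1) → ℝ := fun k => -(((k : ℕ) + 1 : ℝ) / (l + 1))
  have hν : Function.Injective ν := by
    intro k k' h
    simp only [ν, neg_inj] at h
    rw [div_left_inj' (by positivity), add_left_inj] at h
    exact Fin.ext (by exact_mod_cast h)
  have hdet : ((Matrix.vandermonde ν).transpose).det ≠ 0 := by
    rw [Matrix.det_transpose]
    exact Matrix.det_vandermonde_ne_zero_iff.mpr hν
  refine ⟨ν, ((Matrix.vandermonde ν).transpose)⁻¹.mulVec 1, fun k => ⟨?_, ?_⟩, fun b hb => ?_⟩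
  · simp only [ν, neg_le_neg_iff]
    rw [div_le_one (by positivity)]
    have : (k : ℕ) ≤ l := by omega
    have : ((k : ℕ) : ℝ) ≤ l := by exact_mod_cast this
    linarith
  · simp only [ν, neg_lt_zero]
    positivity
  · have h := congrFun (Matrix.mulVec_mulVec (1 : Fin (l + 1) → ℝ) (Matrix.vandermonde ν).transpose
      ((Matrix.vandermonde ν).transpose)⁻¹) ⟨b, by omega⟩
    rw [Matrix.mul_nonsing_inv _ (isUnit_iff_ne_zero.mpr hdet), Matrix.one_mulVec] at h
    simp only [Pi.one_apply] at h
    rw [← h, Matrix.mulVec, dotProduct]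
    exact Finset.sum_congr rfl fun k _ => by
      rw [Matrix.transpose_apply, Matrix.vandermonde_apply, mul_comm]

theorem det_scaleCoordLinear_ne_zero {n : ℕ} (i : Fin n) {ν : ℝ} (hν : ν ≠ 0) :
    LinearMap.det (scaleCoordLinear i ν : EuclideanSpace ℝ (Fin n) →ₗ[ℝ] EuclideanSpace ℝ (Fin n))
      ≠ 0 := by
  have h : (scaleCoordLinear i ν⁻¹ : EuclideanSpace ℝ (Fin n) →ₗ[ℝ] EuclideanSpace ℝ (Fin n)) ∘ₗ
      (scaleCoordLinear i ν : EuclideanSpace ℝ (Fin n) →ₗ[ℝ] EuclideanSpace ℝ (Fin n))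
      = LinearMap.id := by
    ext v k
    change scaleCoordLinear i ν⁻¹ (scaleCoordLinear i ν v) k = v k
    rw [scaleCoordLinear_apply, scaleCoordLinear_apply]
    split_ifs
    · rw [← mul_assoc, inv_mul_cancel₀ hν, one_mul]
    · simp
  have := congrArg LinearMap.det h
  rw [LinearMap.det_comp, LinearMap.det_id] at this
  exact right_ne_zero_of_mul_eq_one this

theorem exists_eLpNorm_comp_scaleCoord_le {n : ℕ} (i : Fin n) {s : ℝ} (hs : s * s = 1) (a : ℝ)
    {ν : ℝ} (hν : ν ≠ 0) : ∃ K : ℝ≥0, ∀ g : EuclideanSpace ℝ (Fin n) → ℝ, Measurable g →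
      eLpNorm (fun x => g (scaleCoord i s a ν x)) 2 volume ≤ K * eLpNorm g 2 volume := by
  set L := (scaleCoordLinear i ν : EuclideanSpace ℝ (Fin n) →ₗ[ℝ] EuclideanSpace ℝ (Fin n)) with hL
  have hdet := det_scaleCoordLinear_ne_zero i hν
  set q : ℝ≥0 := ‖(LinearMap.det L)⁻¹‖₊ with hq
  refine ⟨q ^ (1 / 2 : ℝ), fun g hg => ?_⟩
  have hmap : Measure.map (scaleCoord i s a ν) volume = (q : ℝ≥0∞) • volume := by
    have e : scaleCoord i s a ν = (fun y => y + ((ν - 1) * s * a) • EuclideanSpace.single i (1 : ℝ)) ∘ L :=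
      funext (scaleCoord_eq hs a ν)
    rw [e, ← Measure.map_map (by fun_prop) L.continuous_of_finiteDimensional.measurable,
      Measure.map_linearMap_addHaar_eq_smul_addHaar _ hdet, Measure.map_smul,
      map_add_right_eq_self]
    congr 1
    rw [← Real.norm_eq_abs, ofReal_norm]
    rfl
  have := eLpNorm_map_measure (p := 2) (μ := volume) (g := g) (f := scaleCoord i s a ν)
    hg.aestronglyMeasurable (continuous_scaleCoord i s a ν).measurable.aemeasurable
  have e2 : (fun x => g (scaleCoord i s a ν x)) = g ∘ scaleCoord i s a ν := rfl
  rw [e2, ← this, hmap, eLpNorm_smul_measure_of_ne_top (by norm_num), smul_eq_mul,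
    ENNReal.coe_rpow_of_nonneg _ (by norm_num)]
  simp

/-- Each reflected term is an affine change of variables, which costs a power of its determinant. No
moment condition is imposed on c, so the bound applies to the coefficients of all derivatives. -/
theorem exists_eLpNorm_reflectExt_le {n M : ℕ} (i : Fin n) {s : ℝ} (hs : s * s = 1) (a : ℝ)
    {ν : Fin M → ℝ} (hν : ∀ k, ν k ≠ 0) (c : Fin M → ℝ) {D D' : Set (EuclideanSpace ℝ (Fin n))}
    (hD : MeasurableSet D) (hD' : MeasurableSet D')
    (h1 : ∀ x ∈ D', 0 ≤ s * x i + a → x ∈ D)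
    (h2 : ∀ x ∈ D', s * x i + a < 0 → ∀ k, scaleCoord i s a (ν k) x ∈ D) :
    ∃ K : ℝ≥0, ∀ G : EuclideanSpace ℝ (Fin n) → ℝ, Continuous G →
      eLpNorm (reflectExt i s a ν c G) 2 (volume.restrict D')
        ≤ K * eLpNorm G 2 (volume.restrict D) := by
  choose κ hκ using fun k => exists_eLpNorm_comp_scaleCoord_le i hs a (hν k)
  refine ⟨1 + ∑ k, ‖c k‖₊ * κ k, fun G hG => ?_⟩
  set g : EuclideanSpace ℝ (Fin n) → ℝ := D.indicator fun x => ‖G x‖ with hg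
  have hgm : Measurable g := hG.norm.measurable.indicator hD
  have hg0 : ∀ x, 0 ≤ g x := fun x => Set.indicator_nonneg (fun _ _ => norm_nonneg _) x
  have hgn : eLpNorm g 2 volume = eLpNorm G 2 (volume.restrict D) := by
    rw [hg, eLpNorm_indicator_eq_eLpNorm_restrict hD, eLpNorm_norm]
  have hterm : ∀ k, Measurable fun x => ‖c k‖ * g (scaleCoord i s a (ν k) x) := by fun_prop
  have hpt : ∀ x ∈ D', ‖reflectExt i s a ν c G x‖
      ≤ g x + ∑ k, ‖c k‖ * g (scaleCoord i s a (ν k) x) := by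
    intro x hx
    have hS : 0 ≤ ∑ k, ‖c k‖ * g (scaleCoord i s a (ν k) x) :=
      Finset.sum_nonneg fun k _ => mul_nonneg (norm_nonneg _) (hg0 _)
    unfold reflectExt
    split_ifs with h
    · rw [hg, Set.indicator_of_mem (h1 x hx h)]
      exact le_add_of_nonneg_right hS
    · refine le_trans ?_ (le_add_of_nonneg_left (hg0 x))
      refine (norm_sum_le _ _).trans (Finset.sum_le_sum fun k _ => ?_)
      rw [norm_mul, hg, Set.indicator_of_mem (h2 x hx (not_le.mp h) k)]
  calc eLpNorm (reflectExt i s a ν c G) 2 (volume.restrict D')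
      ≤ eLpNorm (fun x => g x + ∑ k, ‖c k‖ * g (scaleCoord i s a (ν k) x)) 2 (volume.restrict D') :=
        eLpNorm_mono_ae_real ((ae_restrict_mem hD').mono hpt)
    _ ≤ eLpNorm (fun x => g x + ∑ k, ‖c k‖ * g (scaleCoord i s a (ν k) x)) 2 volume :=
        eLpNorm_mono_measure _ Measure.restrict_le_self
    _ ≤ eLpNorm g 2 volume + ∑ k, eLpNorm (fun x => ‖c k‖ * g (scaleCoord i s a (ν k) x)) 2 volume := by
        refine (eLpNorm_add_le hgm.aestronglyMeasurable (by
          apply Measurable.aestronglyMeasurable; fun_prop) (by norm_num)).trans ?_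
        gcongr
        have := eLpNorm_sum_le (s := Finset.univ) (p := 2) (μ := volume)
          (f := fun k x => ‖c k‖ * g (scaleCoord i s a (ν k) x))
          (fun k _ => (hterm k).aestronglyMeasurable) (by norm_num)
        have e : (∑ k, fun x => ‖c k‖ * g (scaleCoord i s a (ν k) x))
            = fun x => ∑ k, ‖c k‖ * g (scaleCoord i s a (ν k) x) := by
          ext x
          simp
        rwa [e] at this
    _ ≤ eLpNorm g 2 volume + ∑ k, ‖c k‖ₑ * (κ k * eLpNorm g 2 volume) := by
        gcongr with k
        rw [← enorm_norm (c k), ← smul_eq_mul, ← smul_eq_mul]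
        refine (eLpNorm_const_smul_le (c := ‖c k‖)
          (f := fun x => g (scaleCoord i s a (ν k) x))).trans ?_
        exact mul_le_mul' le_rfl (hκ k g hgm)
    _ = _ := by
        rw [hgn]
        push_cast
        rw [add_mul, one_mul, Finset.sum_mul]
        simp only [mul_assoc]
        rfl

/-- One reflection step extends `C^l` functions across the hyperplane `s * x i + a = 0`, with
control of all pure derivatives in `L²`. -/
theorem exists_reflection_step {n : ℕ} (l : ℕ) (i : Fin n) {s : ℝ} (hs : s * s = 1) (a : ℝ)
    {D D' : Set (EuclideanSpace ℝ (Fin n))}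
    (hD : MeasurableSet D) (hD' : MeasurableSet D')
    (h1 : ∀ x ∈ D', 0 ≤ s * x i + a → x ∈ D)
    (h2 : ∀ x ∈ D', s * x i + a < 0 → ∀ ν : ℝ, -1 ≤ ν → ν < 0 → scaleCoord i s a ν x ∈ D) :
    ∃ K : ℝ≥0, ∀ G : EuclideanSpace ℝ (Fin n) → ℝ, ContDiff ℝ l G →
      ∃ F : EuclideanSpace ℝ (Fin n) → ℝ, ContDiff ℝ l F ∧ (∀ x, 0 ≤ s * x i + a → F x = G x) ∧
        ∀ j, ∀ m ≤ l, eLpNorm ((partialDeriv j)^[m] F) 2 (volume.restrict D')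
          ≤ K * eLpNorm ((partialDeriv j)^[m] G) 2 (volume.restrict D) := by
  obtain ⟨ν, c, hν, hc⟩ := exists_reflection_coeff l
  choose κ hκ using fun (j : Fin n) (m : ℕ) => exists_eLpNorm_reflectExt_le i hs a
    (fun k => (hν k).2.ne) ((derivCoeff i j ν)^[m] c) hD hD' h1
    (fun x hx hx0 k => h2 x hx hx0 _ (hν k).1 (hν k).2)
  -- Each derivative has its own coefficients and constant; the sum dominates all of them.
  refine ⟨∑ j, ∑ m ∈ Finset.range (l + 1), κ j m, fun G hG =>
    ⟨reflectExt i s a ν c G, contDiff_reflectExt i hs a l hc hG, fun x hx => if_pos hx,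
      fun j m hm => ?_⟩⟩
  rw [iterate_partialDeriv_reflectExt i j hs a m hm hc hG]
  have hcont : Continuous ((partialDeriv j)^[m] G) :=
    (ContDiff.iterate_partialDeriv j 0 m (hG.of_le (by simpa using hm))).continuous
  refine (hκ j m _ hcont).trans ?_
  gcongr
  refine le_trans ?_ (Finset.single_le_sum (f := fun j => ∑ m ∈ Finset.range (l + 1), κ j m)
    (fun _ _ => zero_le) (Finset.mem_univ j))
  exact Finset.single_le_sum (f := fun m => κ j m) (fun _ _ => zero_le)
    (Finset.mem_range.mpr (by omega))

/-- The closed box with corners `α` and `β`. -/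
noncomputable def coordBox {n : ℕ} (α β : Fin n → ℝ) : Set (EuclideanSpace ℝ (Fin n)) :=
  {x | ∀ j, x j ∈ Set.Icc (α j) (β j)}

theorem isCompact_coordBox {n : ℕ} (α β : Fin n → ℝ) : IsCompact (coordBox α β) := by
  have : coordBox α β = (PiLp.continuousLinearEquiv 2 ℝ fun _ : Fin n => ℝ).toHomeomorph ⁻¹'
      (Set.univ.pi fun j => Set.Icc (α j) (β j)) := by
    ext x
    simp only [coordBox, Set.mem_preimage, Set.mem_univ_pi]
    rfl
  rw [this, Homeomorph.isCompact_preimage]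
  exact isCompact_univ_pi fun j => isCompact_Icc

theorem measurableSet_coordBox {n : ℕ} (α β : Fin n → ℝ) : MeasurableSet (coordBox α β) :=
  (isCompact_coordBox α β).measurableSet

theorem paramDomain_eq_coordBox (n : ℕ) : paramDomain n = coordBox (fun _ => 0) (fun _ => 1) := rfl

/-- Two reflections: across x_i = 0, from [0,1] to [-1,1], then across x_i = 1 (s = -1, a = 1), from
[-1,1] to [-1,2]. -/
theorem exists_extension_coord {n : ℕ} (l : ℕ) (i : Fin n) {α β : Fin n → ℝ} (hα : α i = 0)
    (hβ : β i = 1) :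
    ∃ K : ℝ≥0, ∀ G : EuclideanSpace ℝ (Fin n) → ℝ, ContDiff ℝ l G →
      ∃ F : EuclideanSpace ℝ (Fin n) → ℝ, ContDiff ℝ l F ∧ (∀ x, x i ∈ Set.Icc 0 1 → F x = G x) ∧
        ∀ j, ∀ m ≤ l, eLpNorm ((partialDeriv j)^[m] F) 2
            (volume.restrict (coordBox (Function.update α i (-1)) (Function.update β i 2)))
          ≤ K * eLpNorm ((partialDeriv j)^[m] G) 2 (volume.restrict (coordBox α β)) := by
  obtain ⟨K₁, h₁⟩ := exists_reflection_step l i (s := 1) (by norm_num) 0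
    (measurableSet_coordBox α β) (measurableSet_coordBox (Function.update α i (-1)) β)
    (by
      intro x hx h0 j
      by_cases h : j = i
      · subst h
        rw [hα]
        exact ⟨by linarith, (hx j).2⟩
      · simpa [h] using hx j)
    (by
      intro x hx h0 ν hν1 hν0 j
      by_cases h : j = i
      · subst h
        have h1 := scaleCoord_apply_same (i := j) (s := 1) (by norm_num) 0 ν x
        have h2 := hx j
        simp only [Function.update_self] at h2
        rw [hα, hβ]
        constructor <;> nlinarith [h2.1]
      · rw [scaleCoord_apply_of_ne h]
        simpa [h] using hx j)
  obtain ⟨K₂, h₂⟩ := exists_reflection_step l i (s := -1) (by norm_num) 1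
    (measurableSet_coordBox (Function.update α i (-1)) β)
    (measurableSet_coordBox (Function.update α i (-1)) (Function.update β i 2))
    (by
      intro x hx h0 j
      by_cases h : j = i
      · subst h
        rw [hβ]
        exact ⟨(hx j).1, by linarith⟩
      · simpa [h] using hx j)
    (by
      intro x hx h0 ν hν1 hν0 j
      by_cases h : j = i
      · subst h
        have h1 := scaleCoord_apply_same (i := j) (s := -1) (by norm_num) 1 ν x
        have h2 := hx j
        simp only [Function.update_self] at h2 ⊢
        rw [hβ]
        constructor <;> nlinarith [h2.2]
      · rw [scaleCoord_apply_of_ne h]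
        simpa [h] using hx j)
  refine ⟨K₂ * K₁, fun G hG => ?_⟩
  obtain ⟨F₁, hF₁, hFG, b₁⟩ := h₁ G hG
  obtain ⟨F₂, hF₂, hFF, b₂⟩ := h₂ F₁ hF₁
  refine ⟨F₂, hF₂, fun x hx => ?_, fun j m hm => (b₂ j m hm).trans ?_⟩
  · rw [hFF x (by linarith [hx.2]), hFG x (by linarith [hx.1])]
  · push_cast
    rw [mul_assoc]
    gcongr
    exact b₁ j m hm

/-- Induction over the directions already widened; each step widens one side of the box from [0,1]
to [-1,2]. -/
theorem exists_extension_coordBox {n : ℕ} (l : ℕ) (S : Finset (Fin n)) :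
    ∃ K : ℝ≥0, ∀ G : EuclideanSpace ℝ (Fin n) → ℝ, ContDiff ℝ l G →
      ∃ F : EuclideanSpace ℝ (Fin n) → ℝ, ContDiff ℝ l F ∧ (∀ x ∈ paramDomain n, F x = G x) ∧
        ∀ j, ∀ m ≤ l, eLpNorm ((partialDeriv j)^[m] F) 2 (volume.restrict
            (coordBox (fun j => if j ∈ S then -1 else 0) (fun j => if j ∈ S then 2 else 1)))
          ≤ K * eLpNorm ((partialDeriv j)^[m] G) 2 (volume.restrict (paramDomain n)) := by
  induction S using Finset.induction_on with
  | empty =>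
    exact ⟨1, fun G hG => ⟨G, hG, fun _ _ => rfl, fun j m _ => by
      simp [paramDomain_eq_coordBox]⟩⟩
  | insert i S hi ih =>
    obtain ⟨K₁, h₁⟩ := ih
    obtain ⟨K₂, h₂⟩ := exists_extension_coord l i
      (α := fun j => if j ∈ S then -1 else 0) (β := fun j => if j ∈ S then 2 else 1)
      (if_neg hi) (if_neg hi)
    have eα : ∀ p q : ℝ, Function.update (fun j => if j ∈ S then p else q) i p
        = fun j => if j ∈ insert i S then p else q := by
      intro p q
      ext j
      by_cases h : j = i
      · subst h; simp
      · simp [h]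
    rw [eα, eα] at h₂
    refine ⟨K₂ * K₁, fun G hG => ?_⟩
    obtain ⟨F₁, hF₁, hFG, b₁⟩ := h₁ G hG
    obtain ⟨F₂, hF₂, hFF, b₂⟩ := h₂ F₁ hF₁
    refine ⟨F₂, hF₂, fun x hx => ?_, fun j m hm => (b₂ j m hm).trans ?_⟩
    · rw [hFF x (hx i), hFG x hx]
    · push_cast
      rw [mul_assoc]
      gcongr
      exact b₁ j m hm

/-! ### Leibniz rule, cutoff and compactly supported extension. -/

theorem partialDeriv_add {n : ℕ} (i : Fin n) {f g : EuclideanSpace ℝ (Fin n) → ℝ}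
    (hf : Differentiable ℝ f) (hg : Differentiable ℝ g) :
    partialDeriv i (fun x => f x + g x) = fun x => partialDeriv i f x + partialDeriv i g x := by
  ext x
  simp only [partialDeriv]
  rw [fderiv_fun_add (hf x) (hg x)]
  rfl

theorem partialDeriv_mul {n : ℕ} (i : Fin n) {f g : EuclideanSpace ℝ (Fin n) → ℝ}
    (hf : Differentiable ℝ f) (hg : Differentiable ℝ g) :
    partialDeriv i (fun x => f x * g x)
      = fun x => partialDeriv i f x * g x + f x * partialDeriv i g x := by
  ext x
  simp only [partialDeriv]
  rw [fderiv_fun_mul (hf x) (hg x)]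
  simp only [_root_.add_apply, _root_.smul_apply, smul_eq_mul]
  ring

theorem iterate_partialDeriv_add {n : ℕ} (i : Fin n) (m : ℕ) {f g : EuclideanSpace ℝ (Fin n) → ℝ}
    (hf : ContDiff ℝ m f) (hg : ContDiff ℝ m g) :
    (partialDeriv i)^[m] (fun x => f x + g x)
      = fun x => (partialDeriv i)^[m] f x + (partialDeriv i)^[m] g x := by
  induction m generalizing f g with
  | zero => rfl
  | succ m ih =>
    simp only [Function.iterate_succ_apply]
    rw [partialDeriv_add i (hf.differentiable (by simp)) (hg.differentiable (by simp))]
    exact ih (ContDiff.partialDeriv (m := m) (by exact_mod_cast hf) i)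
      (ContDiff.partialDeriv (m := m) (by exact_mod_cast hg) i)

theorem tsupport_partialDeriv_subset {n : ℕ} (i : Fin n) (f : EuclideanSpace ℝ (Fin n) → ℝ) :
    tsupport (partialDeriv i f) ⊆ tsupport f :=
  (tsupport_fderiv_apply_subset ℝ _)

/-- One derivative splits into χ'F + χF', and the induction hypothesis applies to both, which is why
χ varies in the induction. The support of χ confines the norms of F to D. -/
theorem exists_eLpNorm_iterate_partialDeriv_mul_le {n : ℕ} (i : Fin n)
    {D : Set (EuclideanSpace ℝ (Fin n))} (hD : MeasurableSet D) (m : ℕ)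
    {χ : EuclideanSpace ℝ (Fin n) → ℝ} (hχ : ContDiff ℝ ∞ χ) (hc : HasCompactSupport χ)
    (hχD : tsupport χ ⊆ D) :
    ∃ K : ℝ≥0, ∀ F : EuclideanSpace ℝ (Fin n) → ℝ, ContDiff ℝ m F →
      eLpNorm ((partialDeriv i)^[m] fun x => χ x * F x) 2 volume
        ≤ K * ∑ b ∈ Finset.range (m + 1), eLpNorm ((partialDeriv i)^[b] F) 2 (volume.restrict D) := by
  induction m generalizing χ with
  | zero =>
    obtain ⟨B, hB⟩ := hχ.continuous.bounded_above_of_compact_support hc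
    refine ⟨B.toNNReal, fun F _ => ?_⟩
    simp only [Function.iterate_zero, id, zero_add, Finset.sum_range_one]
    have : ∀ x, ‖χ x * F x‖ ≤ B.toNNReal * ‖D.indicator F x‖ := by
      intro x
      by_cases hx : x ∈ D
      · rw [norm_mul, Set.indicator_of_mem hx]
        gcongr
        exact (hB x).trans (Real.le_coe_toNNReal B)
      · rw [image_eq_zero_of_notMem_tsupport fun h => hx (hχD h)]
        simp only [zero_mul, norm_zero]
        positivity
    have := eLpNorm_le_nnreal_smul_eLpNorm_of_ae_le_mul (Filter.Eventually.of_forall this)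
      (μ := volume) 2
    rwa [eLpNorm_indicator_eq_eLpNorm_restrict hD] at this
  | succ m ih =>
    have hχ' : ContDiff ℝ ∞ (partialDeriv i χ) := ContDiff.partialDeriv (m := ⊤) (by exact_mod_cast hχ) i
    obtain ⟨K₁, h₁⟩ := ih hχ' (hc.partialDeriv i) ((tsupport_partialDeriv_subset i χ).trans hχD)
    obtain ⟨K₂, h₂⟩ := ih hχ hc hχD
    refine ⟨K₁ + K₂, fun F hF => ?_⟩
    have hFm : ContDiff ℝ m F := hF.of_le (by exact_mod_cast Nat.le_succ m)
    have hF' : ContDiff ℝ m (partialDeriv i F) :=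
      ContDiff.partialDeriv (m := m) (by exact_mod_cast hF) i
    have hle : ((m : ℕ∞) : WithTop ℕ∞) ≤ (⊤ : ℕ∞) := by exact_mod_cast le_top
    have c1 : ContDiff ℝ m fun x => partialDeriv i χ x * F x := (hχ'.of_le hle).mul hFm
    have c2 : ContDiff ℝ m fun x => χ x * partialDeriv i F x := (hχ.of_le hle).mul hF'
    have m1 : Continuous ((partialDeriv i)^[m] fun x => partialDeriv i χ x * F x) :=
      (ContDiff.iterate_partialDeriv i 0 m (by simpa using c1)).continuous
    have m2 : Continuous ((partialDeriv i)^[m] fun x => χ x * partialDeriv i F x) :=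
      (ContDiff.iterate_partialDeriv i 0 m (by simpa using c2)).continuous
    rw [Function.iterate_succ_apply, partialDeriv_mul i (hχ.differentiable (by simp))
      (hF.differentiable (by simp)), iterate_partialDeriv_add i m c1 c2]
    refine (eLpNorm_add_le m1.aestronglyMeasurable m2.aestronglyMeasurable (by norm_num)).trans ?_
    push_cast
    rw [add_mul]
    refine add_le_add ((h₁ F hFm).trans ?_) ((h₂ _ hF').trans ?_)
    · gcongr
      omega
    · gcongr
      simp only [← Function.iterate_succ_apply]
      rw [Finset.sum_range_succ' _ (m + 1)]
      exact le_self_add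

/-- The reflected extension is controlled on [-1,2]^n; multiplying it by a cutoff that is 1 on the
cube and supported in that box makes the control global. -/
theorem exists_extension_compactSupport {n : ℕ} (hn : 1 ≤ n) (l : ℕ) :
    ∃ K : ℝ≥0, ∀ G : EuclideanSpace ℝ (Fin n) → ℝ, ContDiff ℝ l G →
      ∃ F : EuclideanSpace ℝ (Fin n) → ℝ, ContDiff ℝ l F ∧ HasCompactSupport F ∧
        (∀ x ∈ paramDomain n, F x = G x) ∧
        eLpNorm F 2 volume + ∑ i, eLpNorm ((partialDeriv i)^[l] F) 2 volume
          ≤ K * ∑ i, ∑ m ∈ Finset.range (l + 1),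
            eLpNorm ((partialDeriv i)^[m] G) 2 (volume.restrict (paramDomain n)) := by
  set D : Set (EuclideanSpace ℝ (Fin n)) := coordBox (fun _ => -1) (fun _ => 2) with hD
  have hDm : MeasurableSet D := measurableSet_coordBox _ _
  obtain ⟨χ, hχ, hχD, hχ1⟩ : ∃ χ : EuclideanSpace ℝ (Fin n) → ℝ, ContDiff ℝ ∞ χ ∧
      tsupport χ ⊆ D ∧ ∀ x ∈ paramDomain n, χ x = 1 := by
    have hU : IsOpen {x : EuclideanSpace ℝ (Fin n) | ∀ j, x j ∈ Set.Ioo (-1 : ℝ) 2} := by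
      simp only [Set.ofPred_forall]
      exact isOpen_iInter_of_finite fun j => isOpen_Ioo.preimage (by fun_prop)
    obtain ⟨f, hf0, hf1, -⟩ := exists_contMDiffMap_zero_one_of_isClosed
      (modelWithCornersSelf ℝ (EuclideanSpace ℝ (Fin n))) (n := (⊤ : ℕ∞)) hU.isClosed_compl
      (isCompact_coordBox (fun _ : Fin n => 0) (fun _ => 1)).isClosed (by
        rw [Set.disjoint_compl_left_iff_subset]
        intro x hx j
        exact ⟨by linarith [(hx j).1], by linarith [(hx j).2]⟩)
    refine ⟨f, f.contMDiff.contDiff, ?_, fun x hx => hf1 hx⟩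
    refine closure_minimal (fun x hx => ?_) (isCompact_coordBox _ _).isClosed
    by_contra h
    refine hx (hf0 fun hxU => h fun j => ?_)
    exact ⟨(hxU j).1.le, (hxU j).2.le⟩
  have hc : HasCompactSupport χ := (isCompact_coordBox _ _).of_isClosed_subset (isClosed_tsupport χ) hχD
  obtain ⟨K₀, h₀⟩ := exists_extension_coordBox (n := n) l Finset.univ
  simp only [Finset.mem_univ, if_true] at h₀
  -- The undifferentiated norm of F is read off as the term m = 0 in some direction, so n ≥ 1 is
  -- needed: for n = 0 the sum over directions is empty.
  let i₀ : Fin n := ⟨0, hn⟩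
  obtain ⟨K₁, h₁⟩ := exists_eLpNorm_iterate_partialDeriv_mul_le i₀ hDm 0 hχ hc hχD
  choose K₂ h₂ using fun i => exists_eLpNorm_iterate_partialDeriv_mul_le i hDm l hχ hc hχD
  refine ⟨(K₁ + ∑ i, K₂ i) * K₀, fun G hG => ?_⟩
  obtain ⟨F, hF, hFG, hb⟩ := h₀ G hG
  have hle : ((l : ℕ∞) : WithTop ℕ∞) ≤ (⊤ : ℕ∞) := by exact_mod_cast le_top
  refine ⟨fun x => χ x * F x, (hχ.of_le hle).mul hF, hc.mul_right,
    fun x hx => by simp only [hχ1 x hx, one_mul, hFG x hx], ?_⟩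
  set Q := ∑ i, ∑ m ∈ Finset.range (l + 1),
            eLpNorm ((partialDeriv i)^[m] G) 2 (volume.restrict (paramDomain n)) with hQ
  have hsum : ∀ i, ∑ b ∈ Finset.range (l + 1), eLpNorm ((partialDeriv i)^[b] F) 2 (volume.restrict D)
      ≤ K₀ * Q := by
    intro i
    calc _ ≤ ∑ b ∈ Finset.range (l + 1), K₀ * eLpNorm ((partialDeriv i)^[b] G) 2
            (volume.restrict (paramDomain n)) :=
          Finset.sum_le_sum fun b hb' => hb i b (by simpa [Nat.lt_succ_iff] using hb')
      _ = K₀ * ∑ b ∈ Finset.range (l + 1), eLpNorm ((partialDeriv i)^[b] G) 2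
            (volume.restrict (paramDomain n)) := by rw [Finset.mul_sum]
      _ ≤ _ := by
          gcongr
          exact Finset.single_le_sum (f := fun i => ∑ m ∈ Finset.range (l + 1),
            eLpNorm ((partialDeriv i)^[m] G) 2 (volume.restrict (paramDomain n)))
            (fun _ _ => zero_le) (Finset.mem_univ i)
  push_cast
  rw [mul_assoc, add_mul, Finset.sum_mul]
  refine add_le_add ((h₁ F (hF.of_le (by simp))).trans ?_) (Finset.sum_le_sum fun i _ =>
    (h₂ i F hF).trans ?_)
  · gcongr
    refine le_trans ?_ (hsum i₀)
    gcongr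
    omega
  · gcongr
    exact hsum i

/-! ### The Barron bound by pure classical derivatives on the cube. -/

theorem exists_barronNorm_le_eLpNorm_partialDeriv {n : ℕ} (hn : 1 ≤ n) {l : ℕ}
    (hl : (n : ℝ) / 2 + 2 < l) :
    ∃ K : ℝ≥0, ∀ G : EuclideanSpace ℝ (Fin n) → ℝ, ContDiff ℝ l G →
      barronNorm (paramDomain n) G ≤ K * ∑ i, ∑ m ∈ Finset.range (l + 1),
        eLpNorm ((partialDeriv i)^[m] G) 2 (volume.restrict (paramDomain n)) := by
  obtain ⟨K₁, h₁⟩ := exists_extension_compactSupport hn l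
  obtain ⟨K₂, h₂⟩ := lintegral_sq_mul_fourier_le n l hl
  obtain ⟨K₃, h₃⟩ := barronNorm_le_lintegral_fourier n
  refine ⟨K₃ * (K₂ * K₁), fun G hG => ?_⟩
  obtain ⟨F, hF, hFc, hFG, hb⟩ := h₁ G hG
  rw [← barronNorm_congr hFG]
  refine (h₃ F hF.continuous hFc).trans ?_
  push_cast
  rw [mul_assoc, mul_assoc]
  gcongr
  refine (h₂ F hF hFc).trans ?_
  gcongr

/-! ### Weak derivatives of functions that agree with smooth ones. -/

section WeakDerivatives

variable {n : ℕ} {U : Set (EuclideanSpace ℝ (Fin n))}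

theorem IsTestFunction.partialDeriv {ψ : EuclideanSpace ℝ (Fin n) → ℝ} (hψ : IsTestFunction U ψ)
    (i : Fin n) : IsTestFunction U (partialDeriv i ψ) :=
  ⟨ContDiff.partialDeriv (m := ⊤) (by exact_mod_cast hψ.1) i, hψ.2.1.partialDeriv i,
    (tsupport_partialDeriv_subset i ψ).trans hψ.2.2⟩

theorem IsTestFunction.iterate_partialDeriv {ψ : EuclideanSpace ℝ (Fin n) → ℝ}
    (hψ : IsTestFunction U ψ) (i : Fin n) (k : ℕ) :
    IsTestFunction U ((_root_.partialDeriv i)^[k] ψ) := by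
  induction k with
  | zero => exact hψ
  | succ k ih => rw [Function.iterate_succ_apply']; exact ih.partialDeriv i

theorem IsTestFunction.foldr_partialDeriv {ψ : EuclideanSpace ℝ (Fin n) → ℝ}
    (hψ : IsTestFunction U ψ) (α : Fin n → ℕ) (L : List (Fin n)) :
    IsTestFunction U (L.foldr (fun i h => (_root_.partialDeriv i)^[α i] h) ψ) := by
  induction L with
  | nil => exact hψ
  | cons i L ih => exact ih.iterate_partialDeriv i (α i)

theorem IsTestFunction.setIntegral_mul {ψ : EuclideanSpace ℝ (Fin n) → ℝ}
    (hψ : IsTestFunction U ψ) (f : EuclideanSpace ℝ (Fin n) → ℝ) :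
    ∫ t in U, f t * ψ t = ∫ t, f t * ψ t :=
  setIntegral_eq_integral_of_forall_compl_eq_zero fun t ht => by
    rw [image_eq_zero_of_notMem_tsupport fun h => ht (hψ.2.2 h), mul_zero]

theorem contDiff_infty_partialDeriv {G : EuclideanSpace ℝ (Fin n) → ℝ}
    (hG : ContDiff ℝ ((⊤ : ℕ∞) : WithTop ℕ∞) G) (i : Fin n) :
    ContDiff ℝ ((⊤ : ℕ∞) : WithTop ℕ∞) (partialDeriv i G) :=
  ContDiff.partialDeriv (m := ⊤) (by exact_mod_cast hG) i

theorem contDiff_infty_iterate_partialDeriv {G : EuclideanSpace ℝ (Fin n) → ℝ}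
    (hG : ContDiff ℝ ((⊤ : ℕ∞) : WithTop ℕ∞) G) (i : Fin n) (k : ℕ) :
    ContDiff ℝ ((⊤ : ℕ∞) : WithTop ℕ∞) ((partialDeriv i)^[k] G) := by
  induction k with
  | zero => exact hG
  | succ k ih => rw [Function.iterate_succ_apply']; exact contDiff_infty_partialDeriv ih i

theorem contDiff_infty_foldl_partialDeriv {G : EuclideanSpace ℝ (Fin n) → ℝ}
    (hG : ContDiff ℝ ((⊤ : ℕ∞) : WithTop ℕ∞) G) (α : Fin n → ℕ) (L : List (Fin n)) :
    ContDiff ℝ ((⊤ : ℕ∞) : WithTop ℕ∞) (L.foldl (fun h i => (partialDeriv i)^[α i] h) G) := by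
  induction L generalizing G with
  | nil => exact hG
  | cons i L ih => exact ih (contDiff_infty_iterate_partialDeriv hG i (α i))

theorem integral_mul_partialDeriv {G ψ : EuclideanSpace ℝ (Fin n) → ℝ}
    (hG : ContDiff ℝ ((⊤ : ℕ∞) : WithTop ℕ∞) G) (hψ : IsTestFunction U ψ) (i : Fin n) :
    ∫ t, G t * partialDeriv i ψ t = -∫ t, partialDeriv i G t * ψ t := by
  have hG' := (contDiff_infty_partialDeriv hG i).continuous
  have hψ' := hψ.partialDeriv i
  refine integral_mul_fderiv_eq_neg_fderiv_mul_of_integrable (v := EuclideanSpace.single i 1) ?_ ?_ ?_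
    (fun x _ => hG.differentiable (by simp) x) (fun x _ => hψ.1.differentiable (by simp) x)
  · exact (hG'.mul hψ.1.continuous).integrable_of_hasCompactSupport hψ.2.1.mul_left
  · exact (hG.continuous.mul hψ'.1.continuous).integrable_of_hasCompactSupport hψ'.2.1.mul_left
  · exact (hG.continuous.mul hψ.1.continuous).integrable_of_hasCompactSupport hψ.2.1.mul_left

theorem integral_mul_iterate_partialDeriv {G ψ : EuclideanSpace ℝ (Fin n) → ℝ}
    (hG : ContDiff ℝ ((⊤ : ℕ∞) : WithTop ℕ∞) G) (hψ : IsTestFunction U ψ) (i : Fin n) (k : ℕ) :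
    ∫ t, G t * (partialDeriv i)^[k] ψ t = (-1) ^ k * ∫ t, (partialDeriv i)^[k] G t * ψ t := by
  induction k generalizing G with
  | zero => simp
  | succ k ih =>
    rw [Function.iterate_succ_apply', Function.iterate_succ_apply,
      integral_mul_partialDeriv hG (hψ.iterate_partialDeriv i k),
      ih (contDiff_infty_partialDeriv hG i)]
    ring

/-- Integration by parts moves one block of derivatives at a time, which reverses their order:
`foldr` on ψ becomes `foldl` on G. Symmetry of mixed derivatives is thus never needed. -/
theorem integral_mul_foldr_partialDeriv {G ψ : EuclideanSpace ℝ (Fin n) → ℝ}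
    (hG : ContDiff ℝ ((⊤ : ℕ∞) : WithTop ℕ∞) G) (hψ : IsTestFunction U ψ) (α : Fin n → ℕ)
    (L : List (Fin n)) :
    ∫ t, G t * L.foldr (fun i h => (partialDeriv i)^[α i] h) ψ t
      = (-1) ^ (L.map α).sum * ∫ t, L.foldl (fun h i => (partialDeriv i)^[α i] h) G t * ψ t := by
  induction L generalizing G with
  | nil => simp
  | cons i L ih =>
    rw [List.foldr_cons, List.foldl_cons, List.map_cons, List.sum_cons,
      integral_mul_iterate_partialDeriv hG (hψ.foldr_partialDeriv α L),
      ih (contDiff_infty_iterate_partialDeriv hG i (α i)), pow_add, mul_assoc]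

theorem foldr_partialDeriv_single (i : Fin n) (m : ℕ) (ψ : EuclideanSpace ℝ (Fin n) → ℝ)
    {L : List (Fin n)} (hL : L.Nodup) :
    L.foldr (fun j h => (partialDeriv j)^[(Pi.single i m : Fin n → ℕ) j] h) ψ
      = if i ∈ L then (partialDeriv i)^[m] ψ else ψ := by
  induction L with
  | nil => simp
  | cons j L ih =>
    obtain ⟨hj, hL⟩ := List.nodup_cons.mp hL
    rw [List.foldr_cons, ih hL]
    by_cases h : j = i
    · subst h
      simp [hj]
    · simp [h, Ne.symm h]

theorem multiDeriv_single (i : Fin n) (m : ℕ) (ψ : EuclideanSpace ℝ (Fin n) → ℝ) :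
    multiDeriv (Pi.single i m) ψ = (partialDeriv i)^[m] ψ := by
  rw [multiDeriv, foldr_partialDeriv_single i m ψ (List.nodup_finRange n),
    if_pos (List.mem_finRange i)]

theorem setIntegral_mul_multiDeriv (hU : MeasurableSet U) {u G ψ : EuclideanSpace ℝ (Fin n) → ℝ}
    (hG : ContDiff ℝ ((⊤ : ℕ∞) : WithTop ℕ∞) G) (hu : ∀ t ∈ U, u t = G t)
    (hψ : IsTestFunction U ψ) (α : Fin n → ℕ) :
    ∫ t in U, u t * multiDeriv α ψ t = (-1) ^ (∑ i, α i) *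
      ∫ t in U, (List.finRange n).foldl (fun h i => (partialDeriv i)^[α i] h) G t * ψ t := by
  rw [hψ.setIntegral_mul]
  have h1 : ∫ t in U, u t * multiDeriv α ψ t = ∫ t in U, G t * multiDeriv α ψ t :=
    setIntegral_congr_fun hU fun t ht => by simp only [hu t ht]
  have h2 : IsTestFunction U (multiDeriv α ψ) := hψ.foldr_partialDeriv α (List.finRange n)
  rw [h1, h2.setIntegral_mul, multiDeriv, integral_mul_foldr_partialDeriv hG hψ, ← List.ofFn_eq_map, List.sum_ofFn]

theorem integrableOn_of_eqOn_continuous {D : Set (EuclideanSpace ℝ (Fin n))} (hD : IsCompact D)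
    (hU : MeasurableSet U) (hUD : U ⊆ D) {u G : EuclideanSpace ℝ (Fin n) → ℝ} (hG : Continuous G)
    (hu : ∀ t ∈ U, u t = G t) : IntegrableOn u U :=
  ((hG.continuousOn.integrableOn_compact hD).mono_set hUD).congr_fun (fun t ht => (hu t ht).symm) hU

theorem memLp_restrict_of_continuous {D : Set (EuclideanSpace ℝ (Fin n))} (hD : IsCompact D)
    (hU : MeasurableSet U) (hUD : U ⊆ D) {G : EuclideanSpace ℝ (Fin n) → ℝ} (hG : Continuous G) :
    MemLp G 2 (volume.restrict U) := by
  have : IsFiniteMeasure (volume.restrict U) :=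
    ⟨by rw [Measure.restrict_apply_univ]; exact (measure_mono hUD).trans_lt hD.measure_lt_top⟩
  obtain ⟨B, hB⟩ := hD.exists_bound_of_continuousOn hG.continuousOn
  exact MemLp.of_bound hG.aestronglyMeasurable B
    ((ae_restrict_mem hU).mono fun t ht => hB t (hUD ht))

theorem memSobolev_of_eqOn_contDiff {D : Set (EuclideanSpace ℝ (Fin n))} (hD : IsCompact D)
    (hU : MeasurableSet U) (hUD : U ⊆ D) {u G : EuclideanSpace ℝ (Fin n) → ℝ}
    (hG : ContDiff ℝ ((⊤ : ℕ∞) : WithTop ℕ∞) G) (hu : ∀ t ∈ U, u t = G t) (l : ℕ) :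
    MemSobolev U l u := by
  intro α _
  have hc := (contDiff_infty_foldl_partialDeriv hG α (List.finRange n)).continuous
  exact ⟨_, ⟨(integrableOn_of_eqOn_continuous hD hU hUD hG.continuous hu).locallyIntegrableOn,
    hc.locallyIntegrable.locallyIntegrableOn U,
    fun ψ hψ => setIntegral_mul_multiDeriv hU hG hu hψ α⟩,
    memLp_restrict_of_continuous hD hU hUD hc⟩

/-- Integration by parts makes the weak and the classical derivative agree against every test
function, and the fundamental lemma of the calculus of variations applies. -/
theorem HasWeakDeriv.ae_eq_iterate_partialDeriv (hU : IsOpen U)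
    {u G g : EuclideanSpace ℝ (Fin n) → ℝ}
    (hG : ContDiff ℝ ((⊤ : ℕ∞) : WithTop ℕ∞) G) (hu : ∀ t ∈ U, u t = G t) {i : Fin n} {m : ℕ}
    (hg : HasWeakDeriv U (Pi.single i m) u g) :
    g =ᵐ[volume.restrict U] (partialDeriv i)^[m] G := by
  have hc := (contDiff_infty_iterate_partialDeriv hG i m).continuous
  have hloc : LocallyIntegrableOn (fun t => g t - (partialDeriv i)^[m] G t) U :=
    hg.2.1.sub (hc.locallyIntegrable.locallyIntegrableOn U)
  have key := hU.ae_eq_zero_of_integral_contDiff_smul_eq_zero hloc fun ψ hψ hψc hψU => by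
    have ht : IsTestFunction U ψ := ⟨hψ, hψc, hψU⟩
    have h1 := hg.2.2 ψ ht
    have h2 : ∫ t in U, u t * multiDeriv (Pi.single i m) ψ t
        = ∫ t in U, G t * multiDeriv (Pi.single i m) ψ t :=
      setIntegral_congr_fun hU.measurableSet fun t ht => by simp only [hu t ht]
    rw [h2, multiDeriv_single, (ht.iterate_partialDeriv i m).setIntegral_mul,
      integral_mul_iterate_partialDeriv hG ht, Finset.sum_pi_single' , if_pos (Finset.mem_univ i),
      ht.setIntegral_mul] at h1
    have h3 := mul_left_cancel₀ (pow_ne_zero m (by norm_num)) h1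
    have i1 : Integrable fun t => ψ t • g t := by
      have h4 : IntegrableOn (fun t => ψ t * g t) (tsupport ψ) :=
        (hg.2.1.integrableOn_compact_subset hψU hψc).continuousOn_mul hψ.continuous.continuousOn hψc
      exact (integrableOn_iff_integrable_of_support_subset
        ((Function.support_mul_subset_left ψ g).trans (subset_tsupport ψ))).mp h4
    have i2 : Integrable fun t => ψ t • (partialDeriv i)^[m] G t :=
      (hψ.continuous.mul hc).integrable_of_hasCompactSupport hψc.mul_right
    simp only [smul_sub]
    rw [integral_sub i1 i2, sub_eq_zero]
    simp only [smul_eq_mul, mul_comm (ψ _)]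
    exact h3.symm
  rw [Filter.EventuallyEq, ae_restrict_iff' hU.measurableSet]
  filter_upwards [key] with t ht htU
  exact sub_eq_zero.mp (ht htU)

theorem single_mem_multiIndices {l m : ℕ} (hm : m ≤ l) (i : Fin n) :
    (Pi.single i m : Fin n → ℕ) ∈ multiIndices n l := by
  simp only [multiIndices, Finset.mem_filter, Fintype.mem_piFinset, Finset.mem_range]
  refine ⟨fun j => ?_, ?_⟩
  · by_cases h : j = i
    · subst h; simp; omega
    · simp [h]
  · simpa using hm

/-- In every family admissible for the infimum the component at the multi-index m·e_i equals ∂_i^m G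
a.e., so this norm is one term of each competing sum. -/
theorem eLpNorm_iterate_partialDeriv_le_sobolevNorm (hU : IsOpen U)
    {u G : EuclideanSpace ℝ (Fin n) → ℝ}
    (hG : ContDiff ℝ ((⊤ : ℕ∞) : WithTop ℕ∞) G) (hu : ∀ t ∈ U, u t = G t) (i : Fin n) {l m : ℕ}
    (hm : m ≤ l) :
    eLpNorm ((partialDeriv i)^[m] G) 2 (volume.restrict U) ≤ sobolevNorm U l u := by
  refine le_iInf₂ fun g hg => ?_
  have hmem := single_mem_multiIndices (n := n) hm i
  rw [← eLpNorm_congr_ae ((hg _ hmem).ae_eq_iterate_partialDeriv hU hG hu)]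
  rw [← ENNReal.rpow_le_rpow_iff (z := 2) (by norm_num), ← ENNReal.rpow_mul]
  norm_num
  exact Finset.single_le_sum (f := fun α => eLpNorm (g α) 2 (volume.restrict U) ^ 2)
    (fun _ _ => zero_le) hmem

end WeakDerivatives

/-! ### From the cube to its interior, and the Barron–Sobolev inequality. -/

theorem convex_paramDomain (n : ℕ) : Convex ℝ (paramDomain n) := by
  intro x hx y hy a b ha hb hab i
  simpa using (convex_Icc (0 : ℝ) 1) (hx i) (hy i) ha hb hab

theorem isCompact_paramDomain (n : ℕ) : IsCompact (paramDomain n) :=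
  isCompact_coordBox _ _

theorem restrict_interior_paramDomain (n : ℕ) :
    volume.restrict (interior (paramDomain n)) = volume.restrict (paramDomain n) :=
  Measure.restrict_congr_set
    (interior_ae_eq_of_null_frontier ((convex_paramDomain n).addHaar_frontier volume))

theorem exists_barronNorm_le_sobolevNorm {n : ℕ} (hn : 1 ≤ n) {l : ℕ}
    (hl : (n : ℝ) / 2 + 2 < l) :
    ∃ K : ℝ≥0, ∀ u G : EuclideanSpace ℝ (Fin n) → ℝ, ContDiff ℝ ((⊤ : ℕ∞) : WithTop ℕ∞) G →
      (∀ t ∈ paramDomain n, u t = G t) →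
      MemSobolev (interior (paramDomain n)) l u ∧ MemBarron (paramDomain n) u ∧
      barronNorm (paramDomain n) u ≤ K * sobolevNorm (interior (paramDomain n)) l u := by
  obtain ⟨K, hK⟩ := exists_barronNorm_le_eLpNorm_partialDeriv hn hl
  -- The sum over directions i and orders m ≤ l has n(l+1) terms, each at most the Sobolev norm.
  refine ⟨K * (n * (l + 1)), fun u G hG hu => ⟨?_, ?_, ?_⟩⟩
  · exact memSobolev_of_eqOn_contDiff (isCompact_paramDomain n) isOpen_interior.measurableSet
      interior_subset hG (fun t ht => hu t (interior_subset ht)) l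
  · rw [MemBarron, barronNorm_congr hu]
    refine (hK G (hG.of_le (by exact_mod_cast le_top))).trans_lt ?_
    refine ENNReal.mul_lt_top ENNReal.coe_lt_top (ENNReal.sum_lt_top.mpr fun i _ =>
      ENNReal.sum_lt_top.mpr fun m _ => ?_)
    exact (memLp_restrict_of_continuous (isCompact_paramDomain n)
      (isCompact_paramDomain n).measurableSet subset_rfl
      (contDiff_infty_iterate_partialDeriv hG i m).continuous).eLpNorm_lt_top
  · rw [barronNorm_congr hu]
    refine (hK G (hG.of_le (by exact_mod_cast le_top))).trans ?_
    push_cast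
    rw [mul_assoc]
    gcongr
    calc _ ≤ ∑ _i : Fin n, ∑ _m ∈ Finset.range (l + 1),
          sobolevNorm (interior (paramDomain n)) l u := by
          refine Finset.sum_le_sum fun i _ => Finset.sum_le_sum fun m hm => ?_
          rw [← restrict_interior_paramDomain]
          exact eLpNorm_iterate_partialDeriv_le_sobolevNorm isOpen_interior hG
            (fun t ht => hu t (interior_subset ht)) i (by simpa [Nat.lt_succ_iff] using hm)
      _ = _ := by simp [mul_assoc]

/-! ### The energy form and its dependence on the parameter. -/

section Galerkin

variable {d : ℕ} {Ω : Set (EuclideanSpace ℝ (Fin d))}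

theorem integrable_mul_mul_of_memLp_top {m : EuclideanSpace ℝ (Fin d) → ℝ}
    (hm : MemLp m ⊤ (volume.restrict Ω)) (p q : Lp ℝ 2 (volume.restrict Ω)) :
    Integrable (fun x => m x * p x * q x) (volume.restrict Ω) := by
  have h : Integrable (fun x => p x * q x) (volume.restrict Ω) :=
    (Lp.memLp p).integrable_mul (Lp.memLp q)
  refine (h.mul_of_top_right hm).congr (Filter.Eventually.of_forall fun x => ?_)
  simp only [Pi.mul_apply]
  ring

/-- The weighted `L²` pairing `(m p, q)_Ω` as a bilinear form. -/
noncomputable def massBilin {m : EuclideanSpace ℝ (Fin d) → ℝ} (hm : MemLp m ⊤ (volume.restrict Ω)) :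
    LinearMap.BilinForm ℝ (Lp ℝ 2 (volume.restrict Ω)) :=
  LinearMap.mk₂ ℝ (fun p q => ∫ x in Ω, m x * p x * q x)
    (fun p p' q => by
      rw [← integral_add (integrable_mul_mul_of_memLp_top hm p q)
        (integrable_mul_mul_of_memLp_top hm p' q)]
      refine integral_congr_ae ?_
      filter_upwards [Lp.coeFn_add p p'] with x hx
      rw [hx, Pi.add_apply]
      ring)
    (fun r p q => by
      rw [smul_eq_mul, ← integral_const_mul]
      refine integral_congr_ae ?_
      filter_upwards [Lp.coeFn_smul r p] with x hx
      rw [hx, Pi.smul_apply, smul_eq_mul]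
      ring)
    (fun p q q' => by
      rw [← integral_add (integrable_mul_mul_of_memLp_top hm p q)
        (integrable_mul_mul_of_memLp_top hm p q')]
      refine integral_congr_ae ?_
      filter_upwards [Lp.coeFn_add q q'] with x hx
      rw [hx, Pi.add_apply]
      ring)
    (fun r p q => by
      rw [smul_eq_mul, ← integral_const_mul]
      refine integral_congr_ae ?_
      filter_upwards [Lp.coeFn_smul r q] with x hx
      rw [hx, Pi.smul_apply, smul_eq_mul]
      ring)

theorem energyForm_eq {m : EuclideanSpace ℝ (Fin d) → ℝ} (hm : MemLp m ⊤ (volume.restrict Ω))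
    (v w : H10 Ω) :
    energyForm Ω m v w = inner ℝ v.1.snd w.1.snd + massBilin hm v.1.fst w.1.fst := rfl

/-- `energyForm` as a bilinear form. -/
noncomputable def energyBilin {m : EuclideanSpace ℝ (Fin d) → ℝ} (hm : MemLp m ⊤ (volume.restrict Ω)) :
    LinearMap.BilinForm ℝ (H10 Ω) :=
  LinearMap.mk₂ ℝ (energyForm Ω m)
    (fun v v' w => by
      simp only [energyForm_eq hm, Submodule.coe_add, WithLp.add_fst, WithLp.add_snd, inner_add_left, map_add,
        LinearMap.add_apply]
      ring)
    (fun r v w => by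
      simp only [energyForm_eq hm, Submodule.coe_smul, WithLp.smul_fst, WithLp.smul_snd, real_inner_smul_left,
        map_smul, LinearMap.smul_apply, smul_eq_mul]
      ring)
    (fun v w w' => by
      simp only [energyForm_eq hm, Submodule.coe_add, WithLp.add_fst, WithLp.add_snd, inner_add_right, map_add]
      ring)
    (fun r v w => by
      simp only [energyForm_eq hm, Submodule.coe_smul, WithLp.smul_fst, WithLp.smul_snd, real_inner_smul_right,
        map_smul, smul_eq_mul]
      ring)

theorem energyBilin_apply {m : EuclideanSpace ℝ (Fin d) → ℝ}
    (hm : MemLp m ⊤ (volume.restrict Ω)) (v w : H10 Ω) :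
    energyBilin hm v w = energyForm Ω m v w := rfl

/-- Both summands are nonnegative, so both vanish: the first kills the gradient and the second, by
positivity of m, the function itself. No Poincaré inequality is involved. -/
theorem eq_zero_of_energyForm_self_eq_zero {m : EuclideanSpace ℝ (Fin d) → ℝ}
    (hm : MemLp m ⊤ (volume.restrict Ω)) (hpos : ∀ᵐ x ∂(volume.restrict Ω), 0 < m x)
    {v : H10 Ω} (hv : energyForm Ω m v v = 0) : v = 0 := by
  have h0 : 0 ≤ᵐ[volume.restrict Ω] fun x => m x * v.1.fst x * v.1.fst x := by
    filter_upwards [hpos] with x hx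
    rw [mul_assoc]
    exact mul_nonneg hx.le (mul_self_nonneg _)
  have h1 : 0 ≤ ∫ x in Ω, m x * v.1.fst x * v.1.fst x := integral_nonneg_of_ae h0
  have h2 : (0 : ℝ) ≤ inner ℝ v.1.snd v.1.snd := real_inner_self_nonneg
  have hsum : inner ℝ v.1.snd v.1.snd + ∫ x in Ω, m x * v.1.fst x * v.1.fst x = 0 := hv
  have e1 : v.1.snd = 0 := inner_self_eq_zero (𝕜 := ℝ).mp (by linarith)
  have e2 : ∫ x in Ω, m x * v.1.fst x * v.1.fst x = 0 := by linarith
  rw [integral_eq_zero_iff_of_nonneg_ae h0 (integrable_mul_mul_of_memLp_top hm _ _)] at e2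
  have e3 : v.1.fst = 0 := by
    refine (Lp.eq_zero_iff_ae_eq_zero).mpr ?_
    filter_upwards [e2, hpos] with x hx hp
    simpa [hp.ne'] using hx
  refine Subtype.ext ?_
  exact (WithLp.ofLp_injective 2) (Prod.ext e3 e1)

theorem memLp_potential {N : ℕ} {μ₀ : EuclideanSpace ℝ (Fin d) → ℝ}
    {μ : Fin N → EuclideanSpace ℝ (Fin d) → ℝ} (hμ₀ : MemLp μ₀ ⊤ (volume.restrict Ω))
    (hμ : ∀ i, MemLp (μ i) ⊤ (volume.restrict Ω)) (t : EuclideanSpace ℝ (Fin N)) :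
    MemLp (fun x => potential μ₀ μ x t) ⊤ (volume.restrict Ω) :=
  hμ₀.add (memLp_finsetSum _ fun i _ => (hμ i).const_mul (t i))

/-- This makes every entry of the stiffness matrix affine, hence smooth, in t. -/
theorem energyForm_potential {N : ℕ} {μ₀ : EuclideanSpace ℝ (Fin d) → ℝ}
    {μ : Fin N → EuclideanSpace ℝ (Fin d) → ℝ} (hμ₀ : MemLp μ₀ ⊤ (volume.restrict Ω))
    (hμ : ∀ i, MemLp (μ i) ⊤ (volume.restrict Ω)) (t : EuclideanSpace ℝ (Fin N)) (v w : H10 Ω) :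
    energyForm Ω (fun x => potential μ₀ μ x t) v w
      = energyForm Ω μ₀ v w + ∑ i, t i * massBilin (hμ i) v.1.fst w.1.fst := by
  have h1 := integrable_mul_mul_of_memLp_top hμ₀ v.1.fst w.1.fst
  have h2 := fun i => (integrable_mul_mul_of_memLp_top (hμ i) v.1.fst w.1.fst).const_mul (t i)
  have : ∫ x in Ω, potential μ₀ μ x t * v.1.fst x * w.1.fst x
      = (∫ x in Ω, μ₀ x * v.1.fst x * w.1.fst x)
        + ∑ i, t i * ∫ x in Ω, μ i x * v.1.fst x * w.1.fst x := by
    simp only [← integral_const_mul]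
    rw [← integral_finsetSum _ fun i _ => h2 i, ← integral_add h1 (integrable_finsetSum _ fun i _ => h2 i)]
    refine integral_congr_ae (Filter.Eventually.of_forall fun x => ?_)
    simp only [potential, add_mul, Finset.sum_mul, mul_assoc]
  simp only [energyForm, this]
  rw [add_assoc]
  rfl

theorem paramDomain_subset_closure_interior (n : ℕ) :
    paramDomain n ⊆ closure (interior (paramDomain n)) := by
  have hne : (interior (paramDomain n)).Nonempty := by
    have hU : IsOpen {x : EuclideanSpace ℝ (Fin n) | ∀ j, x j ∈ Set.Ioo (0 : ℝ) 1} := by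
      simp only [Set.ofPred_forall]
      exact isOpen_iInter_of_finite fun j => isOpen_Ioo.preimage (by fun_prop)
    refine ⟨WithLp.toLp 2 fun _ => 1 / 2, interior_maximal (fun x hx j => ?_) hU fun j => ?_⟩
    · exact ⟨(hx j).1.le, (hx j).2.le⟩
    · norm_num
  rw [(convex_paramDomain n).closure_interior_eq_closure_of_nonempty_interior hne]
  exact subset_closure

/-- A violation at one point is a violation on an open set, which meets the interior since the cube
lies in the closure of its interior; the intersection has positive measure. -/
theorem forall_mem_paramDomain_of_ae {n : ℕ} {g : EuclideanSpace ℝ (Fin n) → ℝ} (hg : Continuous g)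
    {a : ℝ} (h : ∀ᵐ t ∂(volume.restrict (paramDomain n)), a ≤ g t) :
    ∀ t ∈ paramDomain n, a ≤ g t := by
  intro t ht
  by_contra hlt
  have hO : IsOpen {t | g t < a} := isOpen_lt hg continuous_const
  obtain ⟨y, hyO, hyI⟩ := mem_closure_iff.mp (paramDomain_subset_closure_interior n ht) _ hO
    (not_le.mp hlt)
  have hpos := (hO.inter isOpen_interior).measure_pos volume ⟨y, hyO, hyI⟩
  refine hpos.ne' (measure_mono_null (fun z hz => ?_)
    ((ae_restrict_iff' (isCompact_paramDomain n).measurableSet).mp h))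
  exact fun hz' => (not_le.mpr hz.1) (hz' (interior_subset hz.2))

/-- Fubini gives the bound for a.e. t at a.e. x, and continuity in t then gives it for every t. The
exceptional set of x no longer depends on t, so coercivity holds at each single parameter. -/
theorem ae_forall_le_potential {N : ℕ} {μ₀ : EuclideanSpace ℝ (Fin d) → ℝ}
    {μ : Fin N → EuclideanSpace ℝ (Fin d) → ℝ} {a b : ℝ}
    (h : ∀ᵐ p ∂((volume.restrict Ω).prod (volume.restrict (paramDomain N))),
      a ≤ potential μ₀ μ p.1 p.2 ∧ potential μ₀ μ p.1 p.2 ≤ b) :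
    ∀ᵐ x ∂(volume.restrict Ω), ∀ t ∈ paramDomain N, a ≤ potential μ₀ μ x t := by
  filter_upwards [Measure.ae_ae_of_ae_prod h] with x hx
  refine forall_mem_paramDomain_of_ae ?_ (hx.mono fun t ht => ht.1)
  unfold potential
  fun_prop

/-! ### The Galerkin problem as a parametric linear system. -/

/-- The stiffness matrix of the parametric Galerkin problem. -/
noncomputable def galerkinMatrix {N K : ℕ} (Ω : Set (EuclideanSpace ℝ (Fin d)))
    (μ₀ : EuclideanSpace ℝ (Fin d) → ℝ) (μ : Fin N → EuclideanSpace ℝ (Fin d) → ℝ)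
    {V : Submodule ℝ (H10 Ω)} (φ : Module.Basis (Fin K) ℝ V) (t : EuclideanSpace ℝ (Fin N)) :
    Matrix (Fin K) (Fin K) ℝ :=
  Matrix.of fun j k => energyForm Ω (fun x => potential μ₀ μ x t) (φ k : H10 Ω) (φ j : H10 Ω)

/-- The load vector of the parametric Galerkin problem. -/
noncomputable def galerkinLoad {N K : ℕ} (f₀ : StrongDual ℝ (H10 Ω)) (f : Fin N → StrongDual ℝ (H10 Ω))
    {V : Submodule ℝ (H10 Ω)} (φ : Module.Basis (Fin K) ℝ V) (t : EuclideanSpace ℝ (Fin N)) :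
    Fin K → ℝ :=
  fun j => f₀ (φ j : H10 Ω) + ∑ i, t i * f i (φ j : H10 Ω)

variable {N K : ℕ} {μ₀ : EuclideanSpace ℝ (Fin d) → ℝ} {μ : Fin N → EuclideanSpace ℝ (Fin d) → ℝ}

theorem galerkinMatrix_mulVec (hμ₀ : MemLp μ₀ ⊤ (volume.restrict Ω))
    (hμ : ∀ i, MemLp (μ i) ⊤ (volume.restrict Ω)) {V : Submodule ℝ (H10 Ω)}
    (φ : Module.Basis (Fin K) ℝ V) (t : EuclideanSpace ℝ (Fin N)) (c : Fin K → ℝ) (j : Fin K) :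
    (galerkinMatrix Ω μ₀ μ φ t).mulVec c j
      = energyBilin (memLp_potential hμ₀ hμ t) (∑ k, c k • (φ k : H10 Ω)) (φ j : H10 Ω) := by
  rw [map_sum, LinearMap.sum_apply]
  change ∑ k, galerkinMatrix Ω μ₀ μ φ t j k * c k = _
  refine Finset.sum_congr rfl fun k _ => ?_
  rw [map_smul, LinearMap.smul_apply, smul_eq_mul, mul_comm]
  rfl

theorem isGalerkinCoeff_iff (hμ₀ : MemLp μ₀ ⊤ (volume.restrict Ω))
    (hμ : ∀ i, MemLp (μ i) ⊤ (volume.restrict Ω)) (f₀ : StrongDual ℝ (H10 Ω))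
    (f : Fin N → StrongDual ℝ (H10 Ω)) {V : Submodule ℝ (H10 Ω)}
    (φ : Module.Basis (Fin K) ℝ V) (t : EuclideanSpace ℝ (Fin N)) (c : Fin K → ℝ) :
    IsGalerkinCoeff Ω μ₀ μ f₀ f V φ t c
      ↔ (galerkinMatrix Ω μ₀ μ φ t).mulVec c = galerkinLoad f₀ f φ t := by
  constructor
  · intro h
    ext j
    rw [galerkinMatrix_mulVec hμ₀ hμ]
    exact h _ (φ j).2
  · intro h v hv
    let A : V →ₗ[ℝ] ℝ :=
      (energyBilin (memLp_potential hμ₀ hμ t) (∑ k, c k • (φ k : H10 Ω))).comp V.subtype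
    let B : V →ₗ[ℝ] ℝ :=
      ((f₀ : H10 Ω →ₗ[ℝ] ℝ) + ∑ i, t i • (f i : H10 Ω →ₗ[ℝ] ℝ)).comp V.subtype
    have hB : ∀ w : V, B w = f₀ w + ∑ i, t i * f i w := by
      intro w
      simp [B, LinearMap.sum_apply]
    have hAB : A = B := by
      refine φ.ext fun j => ?_
      rw [hB]
      have := congrFun h j
      rw [galerkinMatrix_mulVec hμ₀ hμ] at this
      exact this
    have := LinearMap.congr_fun hAB ⟨v, hv⟩
    rw [hB] at this
    exact this

/-- A vector c in the kernel gives v = Σ c_k φ_k of zero energy, so v = 0, and c = 0 by linear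
independence. -/
theorem det_galerkinMatrix_ne_zero (hμ₀ : MemLp μ₀ ⊤ (volume.restrict Ω))
    (hμ : ∀ i, MemLp (μ i) ⊤ (volume.restrict Ω)) {V : Submodule ℝ (H10 Ω)}
    (φ : Module.Basis (Fin K) ℝ V) {t : EuclideanSpace ℝ (Fin N)}
    (hpos : ∀ᵐ x ∂(volume.restrict Ω), 0 < potential μ₀ μ x t) :
    (galerkinMatrix Ω μ₀ μ φ t).det ≠ 0 := by
  intro h
  obtain ⟨c, hc0, hc⟩ := Matrix.exists_mulVec_eq_zero_iff.mpr h
  refine hc0 ?_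
  have hv : energyForm Ω (fun x => potential μ₀ μ x t) (∑ k, c k • (φ k : H10 Ω))
      (∑ k, c k • (φ k : H10 Ω)) = 0 := by
    rw [← energyBilin_apply (memLp_potential hμ₀ hμ t), map_sum]
    refine Finset.sum_eq_zero fun j _ => ?_
    rw [map_smul, ← galerkinMatrix_mulVec hμ₀ hμ, hc]
    simp
  have h0 := eq_zero_of_energyForm_self_eq_zero (memLp_potential hμ₀ hμ t) hpos hv
  have h1 : ∑ k, c k • φ k = 0 := by
    refine Subtype.ext ?_
    simpa using h0
  ext k
  exact Fintype.linearIndependent_iff.mp φ.linearIndependent c h1 k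

theorem contDiff_galerkinMatrix (hμ₀ : MemLp μ₀ ⊤ (volume.restrict Ω))
    (hμ : ∀ i, MemLp (μ i) ⊤ (volume.restrict Ω)) {V : Submodule ℝ (H10 Ω)}
    (φ : Module.Basis (Fin K) ℝ V) (j k : Fin K) :
    ContDiff ℝ ((⊤ : ℕ∞) : WithTop ℕ∞) fun t => galerkinMatrix Ω μ₀ μ φ t j k := by
  simp only [galerkinMatrix, Matrix.of_apply, energyForm_potential hμ₀ hμ]
  fun_prop

theorem contDiff_galerkinLoad (f₀ : StrongDual ℝ (H10 Ω)) (f : Fin N → StrongDual ℝ (H10 Ω))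
    {V : Submodule ℝ (H10 Ω)} (φ : Module.Basis (Fin K) ℝ V) (j : Fin K) :
    ContDiff ℝ ((⊤ : ℕ∞) : WithTop ℕ∞) fun t => galerkinLoad f₀ f φ t j := by
  unfold galerkinLoad
  fun_prop

end Galerkin

/-! ### Smooth solutions of parametric linear systems. -/

theorem contDiff_det {E : Type*} [NormedAddCommGroup E] [NormedSpace ℝ E] {K : ℕ}
    {r : WithTop ℕ∞} {A : E → Matrix (Fin K) (Fin K) ℝ}
    (hA : ∀ j k, ContDiff ℝ r fun t => A t j k) : ContDiff ℝ r fun t => (A t).det := by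
  simp only [Matrix.det_apply]
  exact ContDiff.sum fun σ _ => (contDiff_prod fun i _ => hA _ _).const_smul _

/-- The solution of a smooth family of linear systems, invertible on a compact set, agrees there
with a globally smooth function. -/
theorem exists_contDiff_eq_of_mulVec_eq {E : Type*} [NormedAddCommGroup E] [NormedSpace ℝ E]
    {K : ℕ} {A : E → Matrix (Fin K) (Fin K) ℝ} {b : E → Fin K → ℝ} {S : Set E} (hS : IsCompact S)
    (hA : ∀ j k, ContDiff ℝ ((⊤ : ℕ∞) : WithTop ℕ∞) fun t => A t j k)
    (hb : ∀ j, ContDiff ℝ ((⊤ : ℕ∞) : WithTop ℕ∞) fun t => b t j)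
    (hdet : ∀ t ∈ S, (A t).det ≠ 0) (k : Fin K) :
    ∃ G : E → ℝ, ContDiff ℝ ((⊤ : ℕ∞) : WithTop ℕ∞) G ∧
      ∀ t ∈ S, ∀ c, (A t).mulVec c = b t → c k = G t := by
  have hD : ContDiff ℝ ((⊤ : ℕ∞) : WithTop ℕ∞) fun t => (A t).det := contDiff_det hA
  have hC : ContDiff ℝ ((⊤ : ℕ∞) : WithTop ℕ∞) fun t => (A t).cramer (b t) k := by
    simp only [Matrix.cramer_apply]
    refine contDiff_det fun i j => ?_
    by_cases h : j = k
    · subst h; simpa using hb i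
    · simpa [h] using hA i j
  -- Compactness makes invertibility uniform; the square avoids a discussion of signs.
  obtain ⟨δ, hδ, hle⟩ : ∃ δ > 0, ∀ t ∈ S, δ ≤ (A t).det ^ 2 := by
    rcases S.eq_empty_or_nonempty with rfl | hne
    · exact ⟨1, one_pos, by simp⟩
    · obtain ⟨t₀, ht₀, hmin⟩ := hS.exists_isMinOn hne (hD.continuous.pow 2).continuousOn
      exact ⟨(A t₀).det ^ 2, by have := hdet t₀ ht₀; positivity, fun t ht => hmin ht⟩
  -- Cramer's quotient written as (cramer · det)/det², with a denominator that never vanishes: the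
  -- added bump is zero where det² ≥ δ, in particular on S, and equals 1 where det = 0.
  refine ⟨fun t => (A t).cramer (b t) k * (A t).det /
    ((A t).det ^ 2 + (1 - Real.smoothTransition ((A t).det ^ 2 / δ))), ?_, fun t ht c hc => ?_⟩
  · refine (hC.mul hD).div ((hD.pow 2).add (contDiff_const.sub
      (Real.smoothTransition.contDiff.comp ((hD.pow 2).div_const δ)))) fun t => ?_
    rcases eq_or_ne ((A t).det) 0 with h | h
    · simp [h]
    · have := Real.smoothTransition.le_one ((A t).det ^ 2 / δ)
      have : 0 < (A t).det ^ 2 := by positivity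
      linarith
  · have h1 : Real.smoothTransition ((A t).det ^ 2 / δ) = 1 :=
      Real.smoothTransition.one_of_one_le ((one_le_div hδ).mpr (hle t ht))
    have hd := hdet t ht
    have h2 : (A t).cramer (b t) k = (A t).det * c k := by
      rw [← hc, Matrix.cramer_eq_adjugate_mulVec, Matrix.mulVec_mulVec, Matrix.adjugate_mul,
        Matrix.smul_mulVec, Matrix.one_mulVec]
      rfl
    simp only [h1, h2]
    field_simp
    ring

/-! ### The theorem on Galerkin coefficients. -/

theorem mainTheorem7 (N : ℕ) (hN : 1 ≤ N) (l : ℕ) (hl : (N : ℝ) / 2 + 2 < (l : ℝ)) :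
    ∃ C : ℝ≥0,
      ∀ (d : ℕ) (Ω : Set (EuclideanSpace ℝ (Fin d))), IsOpen Ω → Bornology.IsBounded Ω →
      ∀ (μ₀ : EuclideanSpace ℝ (Fin d) → ℝ) (μ : Fin N → EuclideanSpace ℝ (Fin d) → ℝ),
        MemLp μ₀ ⊤ (volume.restrict Ω) → (∀ i, MemLp (μ i) ⊤ (volume.restrict Ω)) →
      ∀ μmin μmax : ℝ, 0 < μmin →
        (∀ᵐ p ∂((volume.restrict Ω).prod (volume.restrict (paramDomain N))),
          μmin ≤ potential μ₀ μ p.1 p.2 ∧ potential μ₀ μ p.1 p.2 ≤ μmax) →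
      ∀ (f₀ : StrongDual ℝ (H10 Ω)) (f : Fin N → StrongDual ℝ (H10 Ω))
        (K : ℕ) (V : Submodule ℝ (H10 Ω)) (φ : Module.Basis (Fin K) ℝ V),
        (∀ t ∈ paramDomain N, ∃! c : Fin K → ℝ, IsGalerkinCoeff Ω μ₀ μ f₀ f V φ t c) ∧
        ∀ u : Fin K → EuclideanSpace ℝ (Fin N) → ℝ,
          (∀ t ∈ paramDomain N, IsGalerkinCoeff Ω μ₀ μ f₀ f V φ t (fun k => u k t)) →
          ∀ k : Fin K,
            MemSobolev (interior (paramDomain N)) l (u k) ∧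
            MemBarron (paramDomain N) (u k) ∧
            barronNorm (paramDomain N) (u k)
              ≤ (C : ℝ≥0∞) * sobolevNorm (interior (paramDomain N)) l (u k) := by
  obtain ⟨C, hC⟩ := exists_barronNorm_le_sobolevNorm hN hl
  refine ⟨C, fun d Ω _ _ μ₀ μ hμ₀ hμ μmin μmax hmin hbd f₀ f K V φ => ?_⟩
  have hae := ae_forall_le_potential hbd
  have hdet : ∀ t ∈ paramDomain N, (galerkinMatrix Ω μ₀ μ φ t).det ≠ 0 := fun t ht =>
    det_galerkinMatrix_ne_zero hμ₀ hμ φ (hae.mono fun x hx => hmin.trans_le (hx t ht))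
  refine ⟨fun t ht => ?_, fun u hu k => ?_⟩
  · simp only [isGalerkinCoeff_iff hμ₀ hμ]
    have hunit := isUnit_iff_ne_zero.mpr (hdet t ht)
    refine ⟨(galerkinMatrix Ω μ₀ μ φ t)⁻¹.mulVec (galerkinLoad f₀ f φ t), ?_, fun c hc => ?_⟩
    · simp only [Matrix.mulVec_mulVec, Matrix.mul_nonsing_inv _ hunit, Matrix.one_mulVec]
    · rw [← hc, Matrix.mulVec_mulVec, Matrix.nonsing_inv_mul _ hunit, Matrix.one_mulVec]
  · obtain ⟨G, hG, huG⟩ := exists_contDiff_eq_of_mulVec_eq (isCompact_paramDomain N)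
      (contDiff_galerkinMatrix hμ₀ hμ φ) (contDiff_galerkinLoad f₀ f φ) hdet k
    -- Off the cube u is arbitrary; only its agreement there with the smooth G enters.
    exact hC (u k) G hG fun t ht =>
      huG t ht (fun k => u k t) ((isGalerkinCoeff_iff hμ₀ hμ f₀ f φ t _).mp (hu t ht))
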